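/- Let $G=(V,E)$ be a finite decomposable graph and let $C_1,\dots,C_k$ be a perfect ordering of its cliques (maximal complete sets): with $H_l=\bigcup_{j\le l}C_j$, $S_l=H_{l-1}\cap C_l$ and $R_l=C_l\setminus S_l$, for every $l>1$ there is $m<l$ with $S_l\subseteq C_m$. For $l=1$ put $S_1=\emptyset$, $R_1=C_1$. Let $\mathcal I=\prod_{\gamma\in V}\mathcal I_\gamma$ be a finite set of cells, with a benchmark level $i^*_\gamma\in\mathcal I_\gamma$ for each $\gamma$, and write $i_D$ for the restriction of $i\in\mathcal I$ to $D\subseteq V$ and $\mathcal I_D=\prod_{\gamma\in D}\mathcal I_\gamma$. Let $N\ge1$ and consider the multinomial Markov model: tables of counts $n\sim\mathcal M(N,p)$, where $p$ is a strictly positive probability vector on $\mathcal I$ such that $X_\gamma$ and $X_\delta$ are conditionally independent given the other variables whenever $\gamma\neq\delta$ are not adjacent in $G$. Let $p^{\rm cond}$ consist of the groups $p^{R_l\mid i_{S_l}}=\big(p^{R_l\mid i_{S_l}}(i_{R_l})\big)_{i_{R_l}\in\mathcal I_{R_l}}$ ($1\le l\le k$, $i_{S_l}\in\mathcal I_{S_l}$)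 of conditional probabilities of the residuals given the separators; the group with $l=1$ is the vector $p^{C_1}$ of marginal probabilities of $C_1$. In each group the coordinates are all the probabilities except the one of the benchmark cell $i^*_{R_l}$; densities are with respect to Lebesgue measure in these coordinates. For an ordered grouping of the parameters, the reference prior is the prior given by the Berger–Bernardo algorithm, defined up to a positive constant as follows. The parameter space is a product of sets $\Theta_1\times\dots\times\Theta_m$, with groups $\theta_1,\dots,\theta_m$ in decreasing order of importance, and $I(\theta)$ is the Fisher information matrix. Let $h_j(\theta)$ be the diagonal block for $\theta_j$ of the inverse of the upper left block of $I(\theta)^{-1}$ belonging to $(\theta_1,\dots,\theta_j)$, and $|h_j|$ its determinant. For compact sets $K_j\subseteq\Theta_j$ define, for $j=m,\dots,1$, conditional densities on $K_j\times\dots\times K_m$ by $\pi_{m+1}=1$ and $$\pi_j(\theta_j,\dots,\theta_m\mid\theta_1,\dots,\theta_{j-1})=\pi_{j+1}(\theta_{j+1},\dots,\theta_m\mid\theta_1,\dots,\theta_j)\,\frac{w_j(\theta_1,\dots,\theta_j)\,1_{K_j}(\theta_j)}{\int_{K_j}w_j(\theta_1,\dots,\theta_{j-1},z)\,dz},\qquad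 w_j=\exp\Big\{\tfrac12E\big[\log|h_j(\theta)|\big]\Big\},$$ where $E$ is the integral over $\theta_{j+1},\dots,\theta_m$ against $\pi_{j+1}(\cdot\mid\theta_1,\dots,\theta_j)$. Then $\pi$ is the reference prior if, for all increasing sequences of products of compact sets with union $\Theta_1\times\dots\times\Theta_m$ and for all fixed $\theta^0$, the ratios $\pi_1(\theta)/\pi_1(\theta^0)$ converge pointwise to a positive multiple of $\pi(\theta)$. Then: 1. $p\mapsto p^{\rm cond}$ is a bijection from the model onto the product over the groups of the open probability simplices, with inverse $p(i)=\prod_{l=1}^kp^{R_l\mid i_{S_l}}(i_{R_l})$. 2. For every order of the groups, a function $\pi$ is the reference prior for $p^{\rm cond}$ if and only if, up to a positive constant factor, it is $$\pi^R(p^{\rm cond})=\Big(\prod_{i_{C_1}\in\mathcal I_{C_1}}p^{C_1}(i_{C_1})\Big)^{-1/2}\prod_{l=2}^k\ \prod_{i_{S_l}\in\mathcal I_{S_l}}\Big(\prod_{i_{R_l}\in\mathcal I_{R_l}}p^{R_l\mid i_{S_l}}(i_{R_l})\Big)^{-1/2}.$$ In particular, the reference prior does not depend on the order of the groups. 3.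 Up to a positive constant factor, $\pi^R$ is the product over the groups of the densities of the Dirichlet distributions with all hyper-parameters equal to $1/2$, and the factor of each group is the Jeffreys prior of the saturated multinomial model, with any sample size $M\ge1$, whose cell probabilities form that group. 4. Every product over the groups of Dirichlet densities with positive hyper-parameters integrates to $1$; in particular the reference prior is proper. These products form a conjugate family: if the prior has hyper-parameters $\alpha^{R_l\mid i_{S_l}}(i_{R_l})$, the posterior given a table $n$ with total $N$ is the product of Dirichlet densities with hyper-parameters $\alpha^{R_l\mid i_{S_l}}(i_{R_l})+n(i_{S_l},i_{R_l})$, where $n(i_{S_l},i_{R_l})$ is the count of the cell $(i_{S_l},i_{R_l})$ of the $C_l$-marginal table. -/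

import Mathlib

noncomputable section

namespace RefPrior

/-! ### Probability vectors in free coordinates

A strictly positive probability vector on a finite set `A` is described by its coordinates at all
points of `A` other than a benchmark point `a₀`. -/

section Simplex

variable {A : Type*} [Fintype A] [DecidableEq A]

/-- The open simplex of strictly positive probability vectors on `A`, in the free coordinates. -/
def openSimplex (a₀ : A) : Set ({a : A // a ≠ a₀} → ℝ) :=
  {x | (∀ a, 0 < x a) ∧ ∑ a, x a < 1}

/-- The full probability vector with free coordinates `x`. -/
def fullProb (a₀ : A) (x : {a : A // a ≠ a₀} → ℝ) (a : A) : ℝ :=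
  if h : a = a₀ then 1 - ∑ b, x b else x ⟨a, h⟩

/-- The density on `openSimplex a₀` of the Dirichlet distribution with hyper-parameter `α`, with
respect to Lebesgue measure in the free coordinates. -/
def dirichletDensity (a₀ : A) (α : A → ℝ) (x : {a : A // a ≠ a₀} → ℝ) : ℝ :=
  Real.Gamma (∑ a, α a) / (∏ a, Real.Gamma (α a)) * ∏ a, fullProb a₀ x a ^ (α a - 1)

/-- The multinomial `M(N, p)` probability of the table of counts `n` (a table with sum `N`). -/
def multinomialProb (p : A → ℝ) (n : A → ℕ) : ℝ :=
  (Nat.multinomial Finset.univ n : ℝ) * ∏ a, p a ^ n a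

/-- All tables of counts on `A` with total count `N`. -/
def countTables (A : Type*) [Fintype A] [DecidableEq A] (N : ℕ) : Finset (A → ℕ) :=
  Finset.piAntidiag Finset.univ N

end Simplex

/-! ### Fisher information and Jeffreys priors -/

/-- The Fisher information matrix at `θ` of the statistical model with probability function
`f θ : Ω → ℝ` carried by the finite set `X`, in the coordinates given by the vectors `b`:
the entries are `E_θ[∂_a log f · ∂_c log f]`. -/
def fisherInfo {E ι Ω : Type*} [AddCommGroup E] [Module ℝ E] (b : ι → E) (X : Finset Ω)
    (f : E → Ω → ℝ) (θ : E) : Matrix ι ι ℝ :=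
  Matrix.of fun a c => ∑ n ∈ X, f θ n *
    (lineDeriv ℝ (fun η => Real.log (f η n)) θ (b a) *
      lineDeriv ℝ (fun η => Real.log (f η n)) θ (b c))

/-- The Jeffreys prior (square root of the determinant of the information matrix) of the saturated
multinomial model `M(M, p)` on `A`, parametrized by the free coordinates of `p`. -/
def jeffreysMultinomial {A : Type*} [Fintype A] [DecidableEq A] (a₀ : A) (M : ℕ)
    (x : {a : A // a ≠ a₀} → ℝ) : ℝ :=
  Real.sqrt (fisherInfo (fun a : {a : A // a ≠ a₀} => (Pi.single a 1 : {a : A // a ≠ a₀} → ℝ))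
    (countTables A M) (fun y => multinomialProb (fullProb a₀ y)) x).det

/-! ### The reference prior for ordered groups of parameters

This is the Berger-Bernardo algorithm. The parameter is `θ = (θ j)_{j : J}`, where the group `θ j`
is the vector of its coordinates `θ j d`, `d : D j`; the parameter space is the product of the
sets `Θ j`. An ordering of the groups is a list of `J`, the first group being the one of highest
inferential importance. -/

section Reference

variable {J : Type*} [Fintype J] [DecidableEq J] {D : J → Type*} [∀ j, Fintype (D j)]
  [∀ j, DecidableEq (D j)]

/-- The coordinate vectors of the parameter space. -/
def coordVec (a : Σ j, D j) : ∀ j, D j → ℝ :=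
  Pi.single a.1 (Pi.single a.2 1)

/-- The determinant `|h_j|`, where `later` is the list of the groups that follow group `j`, and
`Q` is the information matrix: one takes the block of `Q⁻¹` formed by all groups up to and
including `j`, inverts it, and takes its diagonal block for group `j`. -/
def hDet (Q : Matrix (Σ j, D j) (Σ j, D j) ℝ) (later : List J) (j : J) : ℝ :=
  let S : Matrix {a : Σ j, D j // a.1 ∉ later} {a : Σ j, D j // a.1 ∉ later} ℝ :=
    Q⁻¹.submatrix Subtype.val Subtype.val
  let h : Matrix {a : {a : Σ j, D j // a.1 ∉ later} // a.1.1 = j}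
      {a : {a : Σ j, D j // a.1 ∉ later} // a.1.1 = j} ℝ :=
    S⁻¹.submatrix Subtype.val Subtype.val
  h.det

/-- The parameter `θ` with the groups in `later` replaced by `y`. -/
def replace (θ : ∀ j, D j → ℝ) (later : List J) (y : ∀ i : {i : J // i ∈ later}, D i.1 → ℝ) :
    ∀ j, D j → ℝ :=
  fun j => if h : j ∈ later then y ⟨j, h⟩ else θ j

/-- `exp (½ E[log |h_j(θ)|])`, the expectation being over the groups in `later` with respect to
their conditional density `π` given the groups up to and including `j`. If `later` is empty and
`π` is `1` this is `|h_j(θ)|^{1/2}`. -/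
def expHalfLog (Q : (∀ j, D j → ℝ) → Matrix (Σ j, D j) (Σ j, D j) ℝ) (later : List J) (j : J)
    (π : (∀ j, D j → ℝ) → ℝ) (θ : ∀ j, D j → ℝ) : ℝ :=
  Real.exp ((1 / 2) * ∫ y : (∀ i : {i : J // i ∈ later}, D i.1 → ℝ),
    Real.log (hDet (Q (replace θ later y)) later j) * π (replace θ later y))

/-- The conditional reference density of the groups in the list given all the other groups, when
the parameter space is restricted to the product of the sets `K j`. For the list of all the groups
it is the reference density on that product. -/
def condDensity (Q : (∀ j, D j → ℝ) → Matrix (Σ j, D j) (Σ j, D j) ℝ)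
    (K : ∀ j, Set (D j → ℝ)) : List J → (∀ j, D j → ℝ) → ℝ
  | [], _ => 1
  | j :: later, θ =>
    (K j).indicator (fun x =>
        expHalfLog Q later j (condDensity Q K later) (Function.update θ j x) /
          ∫ z in K j, expHalfLog Q later j (condDensity Q K later) (Function.update θ j z)) (θ j) *
      condDensity Q K later θ

/-- `K 0 ⊆ K 1 ⊆ …` are products of compact sets that exhaust the product of the sets `Θ j`. -/
structure IsCompactExhaustion (Θ : ∀ j, Set (D j → ℝ)) (K : ℕ → ∀ j, Set (D j → ℝ)) : Prop where
  compact : ∀ t j, IsCompact (K t j)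
  mono : ∀ j, Monotone fun t => K t j
  union : ∀ j, ⋃ t, K t j = Θ j

/-- `L` lists every group exactly once. -/
def IsOrdering (L : List J) : Prop := L.Nodup ∧ ∀ j, j ∈ L

/-- `π` is (a version of) the reference prior, relative to the ordered groups `L`, of a model with
information matrix `Q` on the product of the sets `Θ j`: for every exhaustion by compact sets the
reference densities on these compact sets, normalized to be `1` at a fixed parameter value, converge
pointwise to a positive multiple of `π`. -/
def IsReferencePrior (Θ : ∀ j, Set (D j → ℝ))
    (Q : (∀ j, D j → ℝ) → Matrix (Σ j, D j) (Σ j, D j) ℝ) (L : List J)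
    (π : (∀ j, D j → ℝ) → ℝ) : Prop :=
  ∀ K : ℕ → ∀ j, Set (D j → ℝ), IsCompactExhaustion Θ K →
    ∀ θ₀ ∈ Set.univ.pi Θ, ∃ c : ℝ, 0 < c ∧ ∀ θ ∈ Set.univ.pi Θ,
      Filter.Tendsto (fun t => condDensity Q (K t) L θ / condDensity Q (K t) L θ₀)
        Filter.atTop (nhds (c * π θ))

end Reference

/-! ### Discrete graphical models -/

section Graph

variable {V : Type*} [Fintype V] [DecidableEq V] {k : ℕ}

/-- `H_{l-1}`, the union of the cliques that precede `C_l`. -/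
def history (C : Fin k → Finset V) (l : Fin k) : Finset V :=
  (Finset.univ.filter fun m => m < l).biUnion C

/-- The separator `S_l = H_{l-1} ∩ C_l`; it is empty for the first clique. -/
def sep (C : Fin k → Finset V) (l : Fin k) : Finset V := history C l ∩ C l

/-- The residual `R_l = C_l \ S_l`; for the first clique it is the clique itself. -/
def res (C : Fin k → Finset V) (l : Fin k) : Finset V := C l \ sep C l

/-- `C` enumerates, without repetition and in a perfect order, the cliques (maximal complete
sets of vertices) of `G`. -/
structure IsPerfectCliqueOrdering (G : SimpleGraph V) (C : Fin k → Finset V) : Prop where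
  injective : Function.Injective C
  cliques : ∀ s : Finset V, s ∈ Set.range C ↔ Maximal (fun t : Finset V => G.IsClique (t : Set V)) s
  perfect : ∀ l : Fin k, 0 < (l : ℕ) → ∃ m < l, sep C l ⊆ C m

variable {Lv : V → Type*} [∀ v, Fintype (Lv v)] [∀ v, DecidableEq (Lv v)]

/-- The entry of the `D`-marginal table of `p` in the marginal cell `x`. -/
def marginal (p : (∀ v, Lv v) → ℝ) (D : Finset V) (x : ∀ v : D, Lv v) : ℝ :=
  ∑ i with D.restrict i = x, p i

/-- The entry, in the cell `r`, of the `s`-slice of the `R`-table of `f`, i.e. the entry of the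
`R ∪ S`-marginal table in the cell `(r, s)`; used for probabilities and for counts. -/
def sliceEntry {M : Type*} [AddCommMonoid M] (f : (∀ v, Lv v) → M) (R S : Finset V)
    (s : ∀ v : S, Lv v) (r : ∀ v : R, Lv v) : M :=
  ∑ i with S.restrict i = s ∧ R.restrict i = r, f i

/-- The conditional probability of the cell `r` of the `R`-table given the cell `s` of the
`S`-table. -/
def condProb (p : (∀ v, Lv v) → ℝ) (R S : Finset V) (s : ∀ v : S, Lv v) (r : ∀ v : R, Lv v) : ℝ :=
  sliceEntry p R S s r / marginal p S s

/-- The strictly positive cell probabilities that are Markov with respect to `G`: for distinct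
non-adjacent `γ`, `δ`, the variables `X_γ` and `X_δ` are independent given all the others. -/
def markovModel (G : SimpleGraph V) : Set ((∀ v, Lv v) → ℝ) :=
  {p | (∀ i, 0 < p i) ∧ ∑ i, p i = 1 ∧
    ∀ γ δ, γ ≠ δ → ¬ G.Adj γ δ → ∀ i : (∀ v, Lv v),
      p i * marginal p {γ, δ}ᶜ (Finset.restrict {γ, δ}ᶜ i) =
        marginal p {γ}ᶜ (Finset.restrict {γ}ᶜ i) * marginal p {δ}ᶜ (Finset.restrict {δ}ᶜ i)}

/-- The groups of `p^cond`: one for each clique `C_l` and each cell `s` of the `S_l`-table. For the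
first clique `S_l` is empty, there is exactly one such cell, and the group is `p^{C_1}`. -/
abbrev Group (Lv : V → Type*) (C : Fin k → Finset V) : Type _ :=
  Σ l : Fin k, ∀ v : sep C l, Lv v

/-- The cells of the table whose probabilities form the group `j`. -/
abbrev Cell (C : Fin k → Finset V) (j : Group Lv C) : Type _ :=
  ∀ v : res C j.1, Lv v

/-- The benchmark cell `i*_{R_l}` of the group `j`. -/
abbrev baseCell (C : Fin k → Finset V) (base : ∀ v, Lv v) (j : Group Lv C) : Cell C j :=
  Finset.restrict (res C j.1) base

/-- The free coordinates of the group `j`. -/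
abbrev Coord (C : Fin k → Finset V) (base : ∀ v, Lv v) (j : Group Lv C) : Type _ :=
  {r : Cell C j // r ≠ baseCell C base j}

/-- Values of the parameter `p^cond`, in free coordinates. -/
abbrev Param (C : Fin k → Finset V) (base : ∀ v, Lv v) : Type _ :=
  ∀ j : Group Lv C, Coord C base j → ℝ

/-- The parameter set of a single group. -/
def groupSpace (C : Fin k → Finset V) (base : ∀ v, Lv v) (j : Group Lv C) :
    Set (Coord C base j → ℝ) :=
  openSimplex (baseCell C base j)

/-- The parameter space of `p^cond`. -/
def paramSpace (C : Fin k → Finset V) (base : ∀ v, Lv v) : Set (Param C base) :=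
  Set.univ.pi (groupSpace C base)

/-- The parameter `p^cond` of the cell probabilities `p`. -/
def pcond (C : Fin k → Finset V) (base : ∀ v, Lv v) (p : (∀ v, Lv v) → ℝ) : Param C base :=
  fun j r => condProb p (res C j.1) (sep C j.1) j.2 r.1

/-- All the probabilities of the group `j` under the parameter value `η`. -/
def groupProb (C : Fin k → Finset V) (base : ∀ v, Lv v) (η : Param C base) (j : Group Lv C)
    (r : Cell C j) : ℝ :=
  fullProb (baseCell C base j) (η j) r

/-- The cell probabilities `p(i) = ∏_l p^{R_l | i_{S_l}}(i_{R_l})` as a function of `p^cond`. -/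
def cellProb (C : Fin k → Finset V) (base : ∀ v, Lv v) (η : Param C base) (i : ∀ v, Lv v) : ℝ :=
  ∏ l : Fin k,
    groupProb C base η ⟨l, Finset.restrict (sep C l) i⟩ (Finset.restrict (res C l) i)

/-- The likelihood of `p^cond` for an observed contingency table `n`. -/
def likelihood (C : Fin k → Finset V) (base : ∀ v, Lv v) (η : Param C base)
    (n : (∀ v, Lv v) → ℕ) : ℝ :=
  multinomialProb (cellProb C base η) n

/-- The information matrix of the multinomial Markov model with sample size `N`, parametrized by
`p^cond`. -/
def infoMatrix (C : Fin k → Finset V) (base : ∀ v, Lv v) (N : ℕ) (η : Param C base) :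
    Matrix (Σ j, Coord C base j) (Σ j, Coord C base j) ℝ :=
  fisherInfo coordVec (countTables (∀ v, Lv v) N) (likelihood C base) η

/-- The product over the groups of all the probabilities in the group to the power `-1/2`. -/
def refKernel (C : Fin k → Finset V) (base : ∀ v, Lv v) (η : Param C base) : ℝ :=
  ∏ l : Fin k, ∏ s : (∀ v : sep C l, Lv v),
    (∏ r : Cell C (⟨l, s⟩ : Group Lv C), groupProb C base η ⟨l, s⟩ r) ^ (-(1 / 2) : ℝ)

/-- The product of Dirichlet densities, one for each group. -/
def dirichletProduct (C : Fin k → Finset V) (base : ∀ v, Lv v)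
    (α : ∀ j : Group Lv C, Cell C j → ℝ) (η : Param C base) : ℝ :=
  ∏ j, dirichletDensity (baseCell C base j) (α j) (η j)

/-- The posterior density of `p^cond` given the table `n`, for the prior density `π`. -/
def posterior (C : Fin k → Finset V) (base : ∀ v, Lv v) (π : Param C base → ℝ)
    (n : (∀ v, Lv v) → ℕ) (η : Param C base) : ℝ :=
  likelihood C base η n * π η / ∫ η' in paramSpace C base, likelihood C base η' n * π η'

end Graph

end RefPrior

end

/-!
Let `t l` denote the conditional probability of the residual `R_l` given the separator `S_l`, as a
function of the full cell. All statements about the model come from a calculus of marginal sums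
(`sumOut`): `t l` depends only on the clique `C_l`, and its sum over the values of the variables in
`R_l` is `1` (`IsKernelFamily`). Consequently the product of such functions marginalizes onto the
first `l` cliques by dropping factors (`IsKernelFamily.sumOut_prod`), its factors are the
conditional probabilities of `R_l` given `S_l` (`IsKernelFamily.condProb_restrict`), and a function
of the first `l + 1` cliques may be replaced by its conditional expectation given the first `l`
(`IsKernelFamily.sum_mul_eq`).

*Parametrization.* Positivity gives the intersection property of conditional independence, so the
pairwise Markov property passes to sets of variables (`CrossAdditive.of_forall`). By perfectness
there is no edge between `R_l` and the history outside `C_l`, hence the last clique splits off as a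
factor, and the marginal of the remaining variables is again pairwise Markov (`exists_factor`).
Induction gives the product formula. Conversely, two non-adjacent vertices never lie in a common
clique, so a product over cliques splits into a factor free of the one and a factor free of the
other.

*Fisher information.* Differentiating the exponentially tilted multinomial theorem gives the second
moments of multinomial tables. The score of a group has conditional mean zero given the preceding
cliques, so scores of different groups are uncorrelated, and the information matrix is block
diagonal. The block of the group `(l, s)` is the information matrix of a saturated multinomial
model with the expected count of the cell `s` of the `S_l`-table as its sample size
(`infoMatrix_eq`). Its determinant is the product of the inverse probabilities in the group times a
power of that expected count, which is a function of the other groups.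

*Reference prior.* Whenever `log |h_j|` is a function of `θ_j` plus a function of the other groups,
the second summand contributes to `w_j` a factor that does not depend on `θ_j`, and normalization
cancels it. On a product of compact sets the reference density is therefore a product over the
groups, for every order of the groups (`condDensity_eq_prod`), and the normalized densities are
eventually equal to the normalized kernel (`IsSeparable.tendsto`).

*Dirichlet family.* The integral of the joint density of independent Gamma variables is evaluated
in two ways, once with the sum of the variables as a coordinate; this gives the Dirichlet integral
(`lintegral_dirichletKernel`). Conjugacy holds because the likelihood is a product of multinomial
likelihoods, one for each group (`likelihood_eq`).
-/

namespace RefPrior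

/-! ### Summing out variables -/

section SumOut

variable {V : Type*} [Fintype V] [DecidableEq V] {Lv : V → Type*} [∀ v, Fintype (Lv v)]
  [∀ v, DecidableEq (Lv v)]

/-- The function obtained from `f` by summing over all values of the variables in `A`. It is still
regarded as a function of the full cell `i`, of which it only uses the coordinates off `A`. -/
def sumOut {M : Type*} [AddCommMonoid M] (A : Finset V) (f : (∀ v, Lv v) → M)
    (i : ∀ v, Lv v) : M :=
  ∑ j with (∀ v ∉ A, j v = i v), f j

section Monoid

variable {M : Type*} [AddCommMonoid M]

theorem sumOut_univ (f : (∀ v, Lv v) → M) (i : ∀ v, Lv v) :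
    sumOut Finset.univ f i = ∑ j, f j := by
  simp [sumOut]

theorem sumOut_empty (f : (∀ v, Lv v) → M) : sumOut ∅ f = f := by
  funext i
  have : (Finset.univ.filter fun j : (∀ v, Lv v) => ∀ v ∉ (∅ : Finset V), j v = i v) = {i} := by
    ext j; simp [funext_iff]
  rw [sumOut, this, Finset.sum_singleton]

theorem sumOut_union {A B : Finset V} (h : Disjoint A B) (f : (∀ v, Lv v) → M) :
    sumOut (A ∪ B) f = sumOut A (sumOut B f) := by
  funext i
  simp only [sumOut]
  rw [Finset.sum_sigma']
  refine Finset.sum_nbij' (fun k => ⟨A.piecewise k i, k⟩) (fun x => x.2) ?_ ?_ ?_ ?_ ?_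
  · intro k hk
    simp only [Finset.mem_filter, Finset.mem_univ, true_and, Finset.mem_union, not_or,
      Finset.mem_sigma] at hk ⊢
    refine ⟨fun v hv => by simp [hv], fun v hv => ?_⟩
    by_cases hA : v ∈ A
    · simp [hA]
    · simp [hA, hk v ⟨hA, hv⟩]
  · rintro ⟨j, k⟩ hk
    simp only [Finset.mem_filter, Finset.mem_univ, true_and, Finset.mem_union, not_or,
      Finset.mem_sigma] at hk ⊢
    intro v hv
    rw [hk.2 v hv.2, hk.1 v hv.1]
  · intro k _
    rfl
  · rintro ⟨j, k⟩ hk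
    simp only [Finset.mem_filter, Finset.mem_univ, true_and, Finset.mem_sigma] at hk
    have : A.piecewise k i = j := by
      funext v
      by_cases hA : v ∈ A
      · simp [hA, hk.2 v (Finset.disjoint_left.1 h hA)]
      · simp [hA, hk.1 v hA]
    simp [this]
  · intro k _
    rfl

theorem dependsOn_sumOut {A : Finset V} {f : (∀ v, Lv v) → M} {D : Set V} (hf : DependsOn f D) :
    DependsOn (sumOut A f) (D \ A) := by
  intro i i' h
  refine Finset.sum_nbij' (fun j => A.piecewise j i') (fun j => A.piecewise j i) ?_ ?_ ?_ ?_ ?_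
  · intro j _
    simp +contextual
  · intro j _
    simp +contextual
  · intro j hj
    simp only [Finset.mem_filter, Finset.mem_univ, true_and] at hj
    funext v
    by_cases hA : v ∈ A
    · simp [hA]
    · simp [hA, hj v hA]
  · intro j hj
    simp only [Finset.mem_filter, Finset.mem_univ, true_and] at hj
    funext v
    by_cases hA : v ∈ A
    · simp [hA]
    · simp [hA, hj v hA]
  · intro j hj
    simp only [Finset.mem_filter, Finset.mem_univ, true_and] at hj
    refine hf fun v hv => ?_
    by_cases hA : v ∈ A
    · simp [hA]
    · simp [hA, hj v hA, h v ⟨hv, by simpa using hA⟩]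

theorem dependsOn_sumOut_compl (D : Finset V) (f : (∀ v, Lv v) → M) :
    DependsOn (sumOut Dᶜ f) (D : Set V) :=
  (dependsOn_sumOut (D := Set.univ) fun _ _ h => congrArg f (funext fun v => h v trivial)).mono
    fun v hv => by simpa using hv

theorem marginal_restrict (p : (∀ v, Lv v) → ℝ) (D : Finset V) (i : ∀ v, Lv v) :
    marginal p D (D.restrict i) = sumOut Dᶜ p i := by
  refine Finset.sum_congr ?_ fun _ _ => rfl
  ext j
  simp [funext_iff]

theorem sliceEntry_restrict (f : (∀ v, Lv v) → M) (R S : Finset V) (i : ∀ v, Lv v) :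
    sliceEntry f R S (S.restrict i) (R.restrict i) = sumOut (S ∪ R)ᶜ f i := by
  refine Finset.sum_congr ?_ fun _ _ => rfl
  ext j
  simp only [funext_iff, Finset.restrict, Subtype.forall, Finset.mem_filter, Finset.mem_univ,
    true_and, Finset.mem_compl, Finset.mem_union, not_not]
  exact ⟨fun h v hv => hv.elim (h.1 v) (h.2 v), fun h => ⟨fun v hv => h v (.inl hv),
    fun v hv => h v (.inr hv)⟩⟩

/-- Summing out the variables in `R` is summing over the cells of the `R`-table. -/
theorem sumOut_eq_sum {R S : Finset V} (h : Disjoint S R) {f : (∀ v, Lv v) → M}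
    (φ : (∀ v : S, Lv v) → (∀ v : R, Lv v) → M)
    (hf : ∀ i, f i = φ (S.restrict i) (R.restrict i)) (i : ∀ v, Lv v) :
    sumOut R f i = ∑ r, φ (S.restrict i) r := by
  refine Finset.sum_nbij' (fun j => R.restrict j)
    (fun r v => if hv : v ∈ R then r ⟨v, hv⟩ else i v) ?_ ?_ ?_ ?_ ?_
  · simp
  · intro r _
    simp +contextual
  · intro j hj
    simp only [Finset.mem_filter, Finset.mem_univ, true_and] at hj
    funext v
    by_cases hv : v ∈ R
    · simp [hv]
    · simp [hv, hj v hv]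
  · intro r _
    funext v
    simp
  · intro j hj
    simp only [Finset.mem_filter, Finset.mem_univ, true_and] at hj
    rw [hf]
    congr 1
    funext v
    exact hj v (Finset.disjoint_left.1 h v.2)

omit [Fintype V] [(v : V) → Fintype (Lv v)] [(v : V) → DecidableEq (Lv v)] in
/-- Every pair of cells of the `S`- and the `R`-table comes from a common cell, if `S` and `R` are
disjoint. -/
theorem exists_restrict_eq {R S : Finset V} (h : Disjoint S R) (base : ∀ v, Lv v)
    (s : ∀ v : S, Lv v) (r : ∀ v : R, Lv v) :
    ∃ i : ∀ v, Lv v, S.restrict i = s ∧ R.restrict i = r := by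
  refine ⟨fun v => if hs : v ∈ S then s ⟨v, hs⟩ else if hr : v ∈ R then r ⟨v, hr⟩ else base v,
    ?_, ?_⟩
  · funext v
    simp
  · funext v
    simp [Finset.disjoint_right.1 h v.2]

theorem sum_sliceEntry (f : (∀ v, Lv v) → M) (R S : Finset V) (s : ∀ v : S, Lv v) :
    ∑ r, sliceEntry f R S s r = ∑ i with S.restrict i = s, f i := by
  rw [← Finset.sum_fiberwise _ (fun i => R.restrict i)]
  refine Finset.sum_congr rfl fun r _ => ?_
  rw [sliceEntry, Finset.filter_filter]

end Monoid

section Semiring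

theorem sumOut_mul_left {A : Finset V} {f g : (∀ v, Lv v) → ℝ} (hg : DependsOn g (Aᶜ : Set V)) :
    sumOut A (fun i => g i * f i) = fun i => g i * sumOut A f i := by
  funext i
  simp only [sumOut]
  rw [Finset.mul_sum]
  refine Finset.sum_congr rfl fun j hj => ?_
  simp only [Finset.mem_filter, Finset.mem_univ, true_and] at hj
  rw [hg fun v hv => hj v (by simpa using hv)]

theorem sumOut_pos {A : Finset V} {f : (∀ v, Lv v) → ℝ} (hf : ∀ i, 0 < f i) (i : ∀ v, Lv v) :
    0 < sumOut A f i :=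
  Finset.sum_pos (fun j _ => hf j) ⟨i, by simp⟩

end Semiring

end SumOut

/-! ### Products of conditional probabilities along a sequence of vertex sets -/

section Factorization

variable {V : Type*} [DecidableEq V] {k : ℕ}

/-- The union of the first `m` sets of the sequence `C`. -/
def initialUnion (C : Fin k → Finset V) (m : ℕ) : Finset V :=
  (Finset.univ.filter fun l : Fin k => (l : ℕ) < m).biUnion C

theorem mem_initialUnion {C : Fin k → Finset V} {m : ℕ} {v : V} :
    v ∈ initialUnion C m ↔ ∃ l : Fin k, (l : ℕ) < m ∧ v ∈ C l := by
  simp [initialUnion]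

theorem mem_sep {C : Fin k → Finset V} {l : Fin k} {v : V} :
    v ∈ sep C l ↔ v ∈ initialUnion C l ∧ v ∈ C l := by
  simp [sep, history, mem_initialUnion]

theorem mem_res {C : Fin k → Finset V} {l : Fin k} {v : V} :
    v ∈ res C l ↔ v ∉ initialUnion C l ∧ v ∈ C l := by
  simp only [res, Finset.mem_sdiff, mem_sep]
  tauto

theorem disjoint_sep_res (C : Fin k → Finset V) (l : Fin k) : Disjoint (sep C l) (res C l) :=
  Finset.disjoint_sdiff

theorem sep_union_res (C : Fin k → Finset V) (l : Fin k) : sep C l ∪ res C l = C l :=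
  Finset.union_sdiff_of_subset Finset.inter_subset_right

theorem mem_initialUnion_succ {C : Fin k → Finset V} {l : Fin k} {v : V} :
    v ∈ initialUnion C (l + 1) ↔ v ∈ initialUnion C l ∨ v ∈ C l := by
  simp only [mem_initialUnion, Nat.lt_succ_iff_lt_or_eq, or_and_right, exists_or]
  refine or_congr Iff.rfl ⟨?_, fun h => ⟨l, rfl, h⟩⟩
  rintro ⟨m, hm, hv⟩
  rwa [← Fin.ext hm]

variable [Fintype V] {Lv : V → Type*} [∀ v, Fintype (Lv v)] [∀ v, DecidableEq (Lv v)]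

/-- `t l` has the formal properties of the conditional probability of the residual of the `l`-th
set given its separator. -/
structure IsKernelFamily (C : Fin k → Finset V) (t : Fin k → (∀ v, Lv v) → ℝ) : Prop where
  dependsOn : ∀ l, DependsOn (t l) (C l : Set V)
  sumOut_res : ∀ l, sumOut (res C l) (t l) = fun _ => 1

/-- The product of the first `m` factors. -/
def partialProd (t : Fin k → (∀ v, Lv v) → ℝ) (m : ℕ) (i : ∀ v, Lv v) : ℝ :=
  ∏ l ∈ (Finset.univ : Finset (Fin k)).filter (fun l : Fin k => (l : ℕ) < m), t l i

omit [DecidableEq V] [Fintype V] [∀ v, Fintype (Lv v)] [∀ v, DecidableEq (Lv v)] in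
theorem partialProd_succ (t : Fin k → (∀ v, Lv v) → ℝ) (l : Fin k) (i : ∀ v, Lv v) :
    partialProd t (l + 1) i = partialProd t l i * t l i := by
  have : (Finset.univ.filter fun m : Fin k => (m : ℕ) < l + 1) =
      insert l (Finset.univ.filter fun m : Fin k => (m : ℕ) < l) := by
    ext m
    simp only [Finset.mem_filter, Finset.mem_univ, true_and, Finset.mem_insert, Fin.ext_iff]
    omega
  rw [partialProd, this, Finset.prod_insert (by simp), mul_comm, partialProd]

omit [DecidableEq V] [Fintype V] [∀ v, Fintype (Lv v)] [∀ v, DecidableEq (Lv v)] in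
theorem partialProd_eq_prod (t : Fin k → (∀ v, Lv v) → ℝ) (i : ∀ v, Lv v) :
    partialProd t k i = ∏ l, t l i := by
  simp [partialProd]

omit [Fintype V] [∀ v, Fintype (Lv v)] [∀ v, DecidableEq (Lv v)] in
theorem dependsOn_partialProd {C : Fin k → Finset V} {t : Fin k → (∀ v, Lv v) → ℝ}
    (ht : ∀ l, DependsOn (t l) (C l : Set V)) (m : ℕ) :
    DependsOn (partialProd t m) (initialUnion C m : Set V) := by
  intro i j h
  refine Finset.prod_congr rfl fun l hl => ht l fun v hv => h v ?_
  exact mem_initialUnion.2 ⟨l, by simpa using hl, hv⟩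

theorem compl_initialUnion (C : Fin k → Finset V) (l : Fin k) :
    (initialUnion C l)ᶜ = res C l ∪ (initialUnion C (l + 1))ᶜ := by
  ext v
  simp only [Finset.mem_union, Finset.mem_compl, mem_res, mem_initialUnion_succ]
  tauto

theorem disjoint_res_compl (C : Fin k → Finset V) (l : Fin k) :
    Disjoint (res C l) (initialUnion C (l + 1))ᶜ := by
  refine Finset.disjoint_left.2 fun v hv => ?_
  simp [mem_initialUnion_succ, (mem_res.1 hv).2]

namespace IsKernelFamily

variable {C : Fin k → Finset V} {t : Fin k → (∀ v, Lv v) → ℝ}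

/-- Marginalizing the product of all the factors onto the first `m` sets drops the later
factors. -/
theorem sumOut_prod (ht : IsKernelFamily C t) (hC : initialUnion C k = Finset.univ) {m : ℕ}
    (hm : m ≤ k) : sumOut (initialUnion C m)ᶜ (partialProd t k) = partialProd t m := by
  induction hm using Nat.decreasingInduction with
  | self => rw [hC, Finset.compl_univ, sumOut_empty]
  | of_succ m hm ih =>
    let l : Fin k := ⟨m, hm⟩
    have h1 := compl_initialUnion C l
    rw [show ((l : ℕ)) = m from rfl] at h1
    rw [h1, sumOut_union (disjoint_res_compl C l), ih]
    have h2 : partialProd t (m + 1) = fun i => partialProd t m i * t l i :=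
      funext fun i => partialProd_succ t l i
    rw [h2, sumOut_mul_left, ht.sumOut_res]
    · simp
    · refine (dependsOn_partialProd ht.dependsOn m).mono fun v hv => ?_
      simp only [Set.mem_compl_iff, SetLike.mem_coe, mem_res]
      exact fun h => h.1 hv

/-- A function `F` of the variables in the first `l + 1` sets has the same expectation as its
conditional expectation given the first `l` sets. -/
theorem sum_mul_eq (ht : IsKernelFamily C t) (hC : initialUnion C k = Finset.univ) (l : Fin k)
    {F : (∀ v, Lv v) → ℝ} (hF : DependsOn F (initialUnion C (l + 1) : Set V)) :
    ∑ i, partialProd t k i * F i =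
      ∑ i, partialProd t k i * sumOut (res C l) (fun j => t l j * F j) i := by
  have key : sumOut (initialUnion C l)ᶜ (fun i => F i * partialProd t k i) =
      sumOut (initialUnion C l)ᶜ
        (fun i => sumOut (res C l) (fun j => t l j * F j) i * partialProd t k i) := by
    have hP : DependsOn (partialProd t l) ((res C l : Set V)ᶜ) :=
      (dependsOn_partialProd ht.dependsOn l).mono fun v hv h => (mem_res.1 h).1 hv
    have hl : ∀ v, v ∈ initialUnion C (l + 1) → v ∉ res C l → v ∈ initialUnion C l := by
      intro v h1 h2
      rw [mem_initialUnion_succ] at h1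
      rw [mem_res] at h2
      tauto
    have hdep : DependsOn (fun j => t l j * F j) (initialUnion C (l + 1) : Set V) := by
      intro i j h
      simp only
      rw [hF h, ht.dependsOn l fun v hv => h v (mem_initialUnion_succ.2 (.inr hv))]
    have hS : DependsOn (sumOut (res C l) (fun j => t l j * F j)) ((initialUnion C l : Set V)) :=
      (dependsOn_sumOut hdep).mono fun v hv => hl v hv.1 hv.2
    rw [sumOut_mul_left (hS.mono fun v hv => by simpa using hv), ht.sumOut_prod hC l.2.le]
    conv_lhs => rw [compl_initialUnion C l, sumOut_union (disjoint_res_compl C l)]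
    rw [sumOut_mul_left (hF.mono fun v hv => by simpa using hv), ht.sumOut_prod hC l.2]
    have h3 : (fun i => F i * partialProd t (l + 1) i) =
        fun i => partialProd t l i * (t l i * F i) := by
      funext i
      rw [partialProd_succ]
      ring
    rw [h3, sumOut_mul_left hP]
    funext i
    ring
  have total : ∀ f : (∀ v, Lv v) → ℝ, ∀ i, ∑ j, f j =
      sumOut (initialUnion C l) (sumOut (initialUnion C l)ᶜ f) i := by
    intro f i
    rw [← sumOut_union disjoint_compl_right, Finset.union_compl, sumOut_univ]
  rcases isEmpty_or_nonempty (∀ v, Lv v) with h | ⟨⟨i⟩⟩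
  · simp
  · simp only [mul_comm (partialProd t k _)]
    rw [total _ i, key, ← total]

theorem sum_prod (ht : IsKernelFamily C t) (hC : initialUnion C k = Finset.univ)
    [h : Nonempty (∀ v, Lv v)] : ∑ i, partialProd t k i = 1 := by
  obtain ⟨i⟩ := h
  have := congrFun (ht.sumOut_prod hC (Nat.zero_le k)) i
  have h0 : (initialUnion C 0)ᶜ = Finset.univ := by
    ext v; simp [mem_initialUnion]
  rw [h0, sumOut_univ] at this
  rw [this]
  simp [partialProd]

theorem disjoint_diff_compl (C : Fin k → Finset V) (l : Fin k) :
    Disjoint (initialUnion C l \ sep C l) (initialUnion C (l + 1))ᶜ := by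
  refine Finset.disjoint_left.2 fun v hv => ?_
  simp [mem_initialUnion_succ, (Finset.mem_sdiff.1 hv).1]

theorem sumOut_clique (ht : IsKernelFamily C t) (hC : initialUnion C k = Finset.univ) (l : Fin k) :
    sumOut (C l)ᶜ (partialProd t k) =
      fun i => t l i * sumOut (initialUnion C l \ sep C l) (partialProd t l) i := by
  have h1 : (C l)ᶜ = (initialUnion C l \ sep C l) ∪ (initialUnion C (l + 1))ᶜ := by
    ext v
    simp only [Finset.mem_union, Finset.mem_compl, Finset.mem_sdiff, mem_sep,
      mem_initialUnion_succ]
    tauto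
  rw [h1, sumOut_union (disjoint_diff_compl C l), ht.sumOut_prod hC l.2, ← sumOut_mul_left]
  · congr 1
    funext i
    rw [partialProd_succ, mul_comm]
  · refine (ht.dependsOn l).mono fun v hv => ?_
    simp only [Set.mem_compl_iff, SetLike.mem_coe, Finset.mem_sdiff, mem_sep]
    have : v ∈ C l := hv
    tauto

/-- The marginal table of a separator is determined by the factors that precede its clique. -/
theorem sumOut_sep (ht : IsKernelFamily C t) (hC : initialUnion C k = Finset.univ) (l : Fin k) :
    sumOut (sep C l)ᶜ (partialProd t k) =
      sumOut (initialUnion C l \ sep C l) (partialProd t l) := by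
  have h2 : (sep C l)ᶜ = res C l ∪ (C l)ᶜ := by
    ext v
    simp only [Finset.mem_union, Finset.mem_compl, mem_sep, mem_res]
    tauto
  have d2 : Disjoint (res C l) (C l)ᶜ := by
    refine Finset.disjoint_left.2 fun v hv => ?_
    simp [(mem_res.1 hv).2]
  have hP : DependsOn (sumOut (initialUnion C l \ sep C l) (partialProd t l))
      ((res C l : Set V)ᶜ) :=
    (dependsOn_sumOut (dependsOn_partialProd ht.dependsOn l)).mono
      fun v hv h => (mem_res.1 h).1 hv.1
  rw [h2, sumOut_union d2, ht.sumOut_clique hC]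
  simp only [mul_comm (t l _)]
  rw [sumOut_mul_left hP, ht.sumOut_res]
  simp

/-- The factors are the conditional probabilities of the residuals given the separators. -/
theorem condProb_restrict (ht : IsKernelFamily C t) (hC : initialUnion C k = Finset.univ)
    (hpos : ∀ i, 0 < partialProd t k i) (l : Fin k) (i : ∀ v, Lv v) :
    condProb (partialProd t k) (res C l) (sep C l) ((sep C l).restrict i) ((res C l).restrict i) =
      t l i := by
  have h := congrFun (ht.sumOut_clique hC l) i
  rw [← ht.sumOut_sep hC] at h
  rw [condProb, sliceEntry_restrict, marginal_restrict, sep_union_res, h,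
    mul_div_cancel_right₀ _ (sumOut_pos hpos i).ne']

end IsKernelFamily

end Factorization

/-! ### Markov distributions and factorization over the cliques -/

section CrossAdditive

variable {V : Type*} [DecidableEq V] {Lv : V → Type*}

/-- The mixed differences of `f` with respect to the variables in `A` and those in `B` vanish. For
the logarithm of a positive density this is the conditional independence of `X_A` and `X_B` given
the other variables. -/
def CrossAdditive (f : (∀ v, Lv v) → ℝ) (A B : Finset V) : Prop :=
  ∀ i j, f i + f ((A ∪ B).piecewise j i) = f (A.piecewise j i) + f (B.piecewise j i)

namespace CrossAdditive

variable {f g : (∀ v, Lv v) → ℝ} {A B : Finset V}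

theorem symm (h : CrossAdditive f A B) : CrossAdditive f B A := fun i j => by
  rw [Finset.union_comm, h i j, add_comm]

theorem of_dependsOn_left (h : DependsOn f ((A : Set V)ᶜ)) : CrossAdditive f A B := fun i j => by
  congr 1
  · refine h fun v hv => ?_
    have hA : v ∉ A := hv
    simp [hA]
  · refine h fun v hv => ?_
    have hA : v ∉ A := hv
    by_cases hB : v ∈ B <;> simp [Finset.piecewise, hA, hB]

theorem of_dependsOn_right (h : DependsOn f ((B : Set V)ᶜ)) : CrossAdditive f A B :=
  (of_dependsOn_left h).symm

theorem add (hf : CrossAdditive f A B) (hg : CrossAdditive g A B) :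
    CrossAdditive (fun i => f i + g i) A B := fun i j => by
  have := hf i j
  have := hg i j
  linarith

theorem sub (hf : CrossAdditive f A B) (hg : CrossAdditive g A B) :
    CrossAdditive (fun i => f i - g i) A B := fun i j => by
  have := hf i j
  have := hg i j
  linarith

/-- Fixing the values of some variables preserves the property. -/
theorem piecewise (hf : CrossAdditive f A B) (R : Finset V) (b : ∀ v, Lv v) :
    CrossAdditive (fun i => f (R.piecewise b i)) A B := fun i j => by
  have key : ∀ T : Finset V, R.piecewise b (T.piecewise j i) =
      T.piecewise (R.piecewise b j) (R.piecewise b i) := by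
    intro T
    funext v
    by_cases hR : v ∈ R <;> by_cases hT : v ∈ T <;> simp [hR, hT]
  simp only [key]
  exact hf _ _

/-- The intersection property of conditional independence. -/
theorem insert_left {γ : V} (hγ : CrossAdditive f {γ} B) (hA : CrossAdditive f A B) :
    CrossAdditive f (insert γ A) B := fun i j => by
  have h1 := hA i j
  have h2 := hγ (A.piecewise j i) j
  have e1 : ({γ} ∪ B).piecewise j (A.piecewise j i) = (insert γ A ∪ B).piecewise j i := by
    funext v
    by_cases h1 : v ∈ A <;> by_cases h2 : v ∈ B <;> by_cases h3 : v = γ <;>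
      simp [Finset.piecewise, h1, h2, h3]
  have e2 : ({γ} : Finset V).piecewise j (A.piecewise j i) = (insert γ A).piecewise j i := by
    funext v
    by_cases h1 : v ∈ A <;> by_cases h3 : v = γ <;> simp [Finset.piecewise, h1, h3]
  have e3 : B.piecewise j (A.piecewise j i) = (A ∪ B).piecewise j i := by
    funext v
    by_cases h1 : v ∈ A <;> by_cases h2 : v ∈ B <;> simp [Finset.piecewise, h1, h2]
  rw [e1, e2, e3] at h2
  linarith

theorem of_forall_left (h : ∀ γ ∈ A, CrossAdditive f {γ} B) : CrossAdditive f A B := by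
  induction A using Finset.induction_on with
  | empty => exact of_dependsOn_left fun i j h => congrArg f (funext fun v => h v (by simp))
  | insert γ A _ ih =>
    exact insert_left (h γ (Finset.mem_insert_self _ _))
      (ih fun δ hδ => h δ (Finset.mem_insert_of_mem hδ))

theorem of_forall (h : ∀ γ ∈ A, ∀ δ ∈ B, CrossAdditive f {γ} {δ}) : CrossAdditive f A B :=
  of_forall_left fun γ hγ => symm <| of_forall_left fun δ hδ => (h γ hγ δ hδ).symm

end CrossAdditive

end CrossAdditive

section Graph

variable {V : Type*} [Fintype V] [DecidableEq V] {G : SimpleGraph V} {k : ℕ}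
  {C : Fin k → Finset V}

namespace IsPerfectCliqueOrdering

theorem exists_subset (hC : IsPerfectCliqueOrdering G C) {s : Finset V}
    (hs : G.IsClique (s : Set V)) : ∃ l, s ⊆ C l := by
  obtain ⟨t, hst, ht⟩ := (Set.toFinite {t : Finset V | G.IsClique (t : Set V)}).exists_le_maximal hs
  obtain ⟨l, hl⟩ := (hC.cliques t).2 ht
  exact ⟨l, hl ▸ hst⟩

omit [Fintype V] in
theorem isClique (hC : IsPerfectCliqueOrdering G C) (l : Fin k) : G.IsClique (C l : Set V) :=
  ((hC.cliques (C l)).1 ⟨l, rfl⟩).1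

theorem initialUnion_eq_univ (hC : IsPerfectCliqueOrdering G C) :
    initialUnion C k = Finset.univ := by
  ext v
  obtain ⟨l, hl⟩ := hC.exists_subset (s := {v}) (by simp)
  simpa using mem_initialUnion.2 ⟨l, l.2, hl (Finset.mem_singleton_self v)⟩

/-- There is no edge between the residual of `C l` and the part of the history outside `C l`. -/
theorem not_adj (hC : IsPerfectCliqueOrdering G C) {l : Fin k} {γ δ : V} (hγ : γ ∈ res C l)
    (hδ : δ ∈ initialUnion C l) (hδ' : δ ∉ C l) : ¬ G.Adj γ δ := by
  intro h
  obtain ⟨m, hm⟩ := hC.exists_subset (s := {γ, δ}) (by simp [SimpleGraph.isClique_insert, h])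
  rw [mem_res] at hγ
  -- The first clique that contains both vertices would be `C l` or an earlier one.
  have key : ∀ m : Fin k, γ ∈ C m → δ ∈ C m → False := by
    intro m
    induction m using WellFoundedLT.induction with
    | _ m ih =>
      intro h1 h2
      rcases lt_trichotomy m l with hlt | rfl | hlt
      · exact hγ.1 (mem_initialUnion.2 ⟨m, hlt, h1⟩)
      · exact hδ' h2
      · obtain ⟨m', hm', hsub⟩ := hC.perfect m (lt_of_le_of_lt (Nat.zero_le _) hlt)
        obtain ⟨n, hn, hδn⟩ := mem_initialUnion.1 hδ
        exact ih m' hm' (hsub (mem_sep.2 ⟨mem_initialUnion.2 ⟨l, hlt, hγ.2⟩, h1⟩))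
          (hsub (mem_sep.2 ⟨mem_initialUnion.2 ⟨n, hn.trans hlt, hδn⟩, h2⟩))
  exact key m (hm (by simp)) (hm (by simp))

end IsPerfectCliqueOrdering

variable {Lv : V → Type*} [∀ v, Fintype (Lv v)] [∀ v, DecidableEq (Lv v)]

theorem crossAdditive_log_of_mem_markovModel {p : (∀ v, Lv v) → ℝ} (hp : p ∈ markovModel G)
    {γ δ : V} (hne : γ ≠ δ) (hadj : ¬ G.Adj γ δ) :
    CrossAdditive (fun i => Real.log (p i)) {γ} {δ} := by
  obtain ⟨hpos, -, hM⟩ := hp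
  have hdep : ∀ {D : Finset V}, DependsOn (fun i => Real.log (sumOut Dᶜ p i)) (D : Set V) :=
    fun {D} i j h => by simp only [dependsOn_sumOut_compl D p h]
  have heq : (fun i => Real.log (p i)) = fun i => Real.log (sumOut {γ}ᶜᶜ p i) +
      Real.log (sumOut {δ}ᶜᶜ p i) - Real.log (sumOut {γ, δ}ᶜᶜ p i) := by
    funext i
    have := hM γ δ hne hadj i
    simp only [marginal_restrict] at this
    rw [← Real.log_mul (sumOut_pos hpos i).ne' (sumOut_pos hpos i).ne', ← this,
      Real.log_mul (hpos i).ne' (sumOut_pos hpos i).ne']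
    ring
  rw [heq]
  refine ((CrossAdditive.of_dependsOn_left ?_).add (CrossAdditive.of_dependsOn_right ?_)).sub
    (CrossAdditive.of_dependsOn_left ?_)
  · exact hdep.mono fun v hv => by simpa using hv
  · exact hdep.mono fun v hv => by simpa using hv
  · refine hdep.mono fun v hv => ?_
    simp only [Finset.coe_compl, Finset.coe_insert, Finset.coe_singleton, Set.mem_compl_iff,
      Set.mem_insert_iff, Set.mem_singleton_iff, not_or] at hv ⊢
    exact hv.1

/-- The step of the factorization that splits off one clique. Since `X_{R_l}` and the variables
outside `C_l` are conditionally independent, `q` is a function of the variables outside `R_l` times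
a function of those in `C_l`; so the ratio of `q` to its marginal depends only on `C_l`. The
marginal inherits the pairwise independences, because a new factor on `S_l` couples only vertices
of a common clique. -/
theorem exists_factor (hC : IsPerfectCliqueOrdering G C) (base : ∀ v, Lv v) (l : Fin k)
    {q : (∀ v, Lv v) → ℝ} (hpos : ∀ i, 0 < q i)
    (hdep : DependsOn q (initialUnion C (l + 1) : Set V))
    (hq : ∀ γ δ, γ ≠ δ → ¬ G.Adj γ δ → CrossAdditive (fun i => Real.log (q i)) {γ} {δ}) :
    (∀ γ δ, γ ≠ δ → ¬ G.Adj γ δ →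
      CrossAdditive (fun i => Real.log (sumOut (res C l) q i)) {γ} {δ}) ∧
    DependsOn (fun i => q i / sumOut (res C l) q i) (C l : Set V) := by
  set R := res C l
  set B := (C l)ᶜ
  set τ : (∀ v, Lv v) → ℝ := fun i => q (B.piecewise base i) / q ((R ∪ B).piecewise base i)
  have hτpos : ∀ i, 0 < τ i := fun i => div_pos (hpos _) (hpos _)
  have hτdep : DependsOn τ (C l : Set V) := by
    intro i j h
    have hB : B.piecewise base i = B.piecewise base j := by
      funext v
      by_cases hv : v ∈ C l
      · simp [B, hv, h v hv]
      · simp [B, hv]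
    have hRB : (R ∪ B).piecewise base i = (R ∪ B).piecewise base j := by
      funext v
      by_cases hv : v ∈ C l
      · simp [Finset.piecewise, B, hv, h v hv]
      · simp [Finset.piecewise, B, hv]
    simp only [τ, hB, hRB]
  have hcross : CrossAdditive (fun i => Real.log (q i)) R B := by
    refine CrossAdditive.of_forall fun γ hγ δ hδ => ?_
    have hδ' : δ ∉ C l := by simpa [B] using hδ
    by_cases hδH : δ ∈ initialUnion C l
    · refine hq γ δ ?_ (hC.not_adj hγ hδH hδ')
      rintro rfl
      exact (mem_res.1 hγ).1 hδH
    · refine CrossAdditive.of_dependsOn_right fun i j h => congrArg Real.log ?_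
      rw [hdep fun v hv => h v ?_]
      rw [SetLike.mem_coe, mem_initialUnion_succ] at hv
      simp only [Finset.coe_singleton, Set.mem_compl_iff, Set.mem_singleton_iff]
      rintro rfl
      tauto
  have hfac : q = fun i => q (R.piecewise base i) * τ i := by
    funext i
    have h := hcross i base
    rw [← Real.log_mul (hpos _).ne' (hpos _).ne', ← Real.log_mul (hpos _).ne' (hpos _).ne'] at h
    have h' := Real.log_injOn_pos (mul_pos (hpos _) (hpos _)) (mul_pos (hpos _) (hpos _)) h
    simp only [τ]
    rw [← mul_div_assoc, ← h', mul_div_cancel_right₀ _ (hpos _).ne']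
  have hsum : sumOut R q = fun i => q (R.piecewise base i) * sumOut R τ i := by
    conv_lhs => rw [hfac]
    refine sumOut_mul_left fun i j h => ?_
    congr 1
    funext v
    by_cases hv : v ∈ R
    · simp [hv]
    · simp [hv, h v hv]
  have hSdep : DependsOn (sumOut R τ) ((C l : Set V) \ R) := dependsOn_sumOut hτdep
  constructor
  · intro γ δ hne hadj
    have hlog : (fun i => Real.log (sumOut R q i)) =
        fun i => Real.log (q (R.piecewise base i)) + Real.log (sumOut R τ i) := by
      funext i
      rw [hsum, Real.log_mul (hpos _).ne' (sumOut_pos hτpos i).ne']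
    rw [hlog]
    refine ((hq γ δ hne hadj).piecewise R base).add ?_
    have hSlog : DependsOn (fun i => Real.log (sumOut R τ i)) (C l : Set V) := fun i j h => by
      simp only
      rw [hSdep fun v hv => h v hv.1]
    by_cases hγ : γ ∈ C l
    · refine CrossAdditive.of_dependsOn_right (hSlog.mono fun v hv => ?_)
      simp only [Finset.coe_singleton, Set.mem_compl_iff, Set.mem_singleton_iff]
      rintro rfl
      exact hadj (hC.isClique l hγ hv hne)
    · refine CrossAdditive.of_dependsOn_left (hSlog.mono fun v hv => ?_)
      simp only [Finset.coe_singleton, Set.mem_compl_iff, Set.mem_singleton_iff]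
      rintro rfl
      exact hγ hv
  · have hratio : (fun i => q i / sumOut R q i) = fun i => τ i / sumOut R τ i := by
      funext i
      rw [hsum, congrFun hfac i]
      exact mul_div_mul_left _ _ (hpos _).ne'
    rw [hratio]
    intro i j h
    simp only
    rw [hτdep h, hSdep fun v hv => h v hv.1]

/-- A positive Markov distribution is the product of a family of kernels along the cliques. -/
theorem exists_isKernelFamily (hC : IsPerfectCliqueOrdering G C) (base : ∀ v, Lv v)
    {p : (∀ v, Lv v) → ℝ} (hp : p ∈ markovModel G) :
    ∃ t, IsKernelFamily C t ∧ partialProd t k = p := by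
  set P : ℕ → (∀ v, Lv v) → ℝ := fun m => sumOut (initialUnion C m)ᶜ p
  have hPpos : ∀ m i, 0 < P m i := fun m => sumOut_pos hp.1
  have hPdep : ∀ m, DependsOn (P m) (initialUnion C m : Set V) := fun m =>
    dependsOn_sumOut_compl _ _
  have hPk : P k = p := by
    simp only [P]
    rw [hC.initialUnion_eq_univ, Finset.compl_univ, sumOut_empty]
  have hPsucc : ∀ l : Fin k, P l = sumOut (res C l) (P (l + 1)) := fun l => by
    simp only [P]
    rw [compl_initialUnion C l, sumOut_union (disjoint_res_compl C l)]
  have hcross : ∀ m, m ≤ k → ∀ γ δ, γ ≠ δ → ¬ G.Adj γ δ →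
      CrossAdditive (fun i => Real.log (P m i)) {γ} {δ} := by
    intro m hm
    induction hm using Nat.decreasingInduction with
    | self =>
      rw [hPk]
      exact fun γ δ => crossAdditive_log_of_mem_markovModel hp
    | of_succ m hm ih =>
      have := (exists_factor hC base ⟨m, hm⟩ (hPpos (m + 1)) (hPdep (m + 1)) ih).1
      rwa [← hPsucc] at this
  set t : Fin k → (∀ v, Lv v) → ℝ := fun l i => P (l + 1) i / P l i
  have hprod : ∀ m, m ≤ k → partialProd t m = P m := by
    intro m
    induction m with
    | zero =>
      intro _
      funext i
      have h0 : (initialUnion C 0)ᶜ = Finset.univ := by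
        ext v; simp [mem_initialUnion]
      simp only [P]
      rw [h0, sumOut_univ, hp.2.1]
      simp [partialProd]
    | succ m ih =>
      intro hm
      funext i
      have := partialProd_succ t ⟨m, hm⟩ i
      simp only at this
      rw [this, ih (by omega)]
      simp only [t]
      rw [mul_div_cancel₀ _ (hPpos m i).ne']
  refine ⟨t, ⟨fun l => ?_, fun l => ?_⟩, by rw [hprod k le_rfl, hPk]⟩
  · have := (exists_factor hC base l (hPpos (l + 1)) (hPdep (l + 1)) (hcross _ l.2)).2
    rwa [← hPsucc] at this
  · have h1 : t l = fun i => (P l i)⁻¹ * P (l + 1) i := by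
      funext i
      simp only [t]
      rw [div_eq_mul_inv, mul_comm]
    have h2 : DependsOn (fun i => (P l i)⁻¹) ((res C l : Set V)ᶜ) := fun i j h => by
      simp only
      rw [hPdep l fun v hv => h v fun hv' => (mem_res.1 hv').1 hv]
    rw [h1, sumOut_mul_left h2, ← hPsucc]
    funext i
    exact inv_mul_cancel₀ (hPpos l i).ne'

/-- A positive product of kernels along the cliques is Markov. -/
theorem partialProd_mem_markovModel (hC : IsPerfectCliqueOrdering G C) [Nonempty (∀ v, Lv v)]
    {t : Fin k → (∀ v, Lv v) → ℝ} (ht : IsKernelFamily C t)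
    (hpos : ∀ i, 0 < partialProd t k i) : partialProd t k ∈ markovModel G := by
  refine ⟨hpos, ht.sum_prod hC.initialUnion_eq_univ, fun γ δ hne hadj i => ?_⟩
  classical
  simp only [marginal_restrict, compl_compl]
  set A : (∀ v, Lv v) → ℝ := fun i => ∏ l with γ ∉ C l, t l i
  set B : (∀ v, Lv v) → ℝ := fun i => ∏ l with ¬ γ ∉ C l, t l i
  have hA : DependsOn A (({γ} : Finset V) : Set V)ᶜ := by
    intro i j h
    refine Finset.prod_congr rfl fun l hl => ht.dependsOn l fun v hv => h v ?_
    simp only [Finset.mem_filter, Finset.mem_univ, true_and] at hl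
    simp only [Finset.coe_singleton, Set.mem_compl_iff, Set.mem_singleton_iff]
    rintro rfl
    exact hl hv
  have hB : DependsOn B (({δ} : Finset V) : Set V)ᶜ := by
    intro i j h
    refine Finset.prod_congr rfl fun l hl => ht.dependsOn l fun v hv => h v ?_
    simp only [Finset.mem_filter, Finset.mem_univ, true_and, not_not] at hl
    simp only [Finset.coe_singleton, Set.mem_compl_iff, Set.mem_singleton_iff]
    rintro rfl
    exact hadj (hC.isClique l hl hv hne)
  have hAB : partialProd t k = fun i => A i * B i := by
    funext i
    rw [partialProd_eq_prod, ← Finset.prod_filter_mul_prod_filter_not _ (fun l => γ ∉ C l)]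
  have hBA : partialProd t k = fun i => B i * A i := by
    rw [hAB]
    exact funext fun i => mul_comm _ _
  have h1 : sumOut {γ} (partialProd t k) = fun i => A i * sumOut {γ} B i := by
    rw [hAB, sumOut_mul_left hA]
  have h2 : sumOut {δ} (partialProd t k) = fun i => B i * sumOut {δ} A i := by
    rw [hBA, sumOut_mul_left hB]
  have hdA : DependsOn (sumOut {δ} A) (({γ} : Finset V) : Set V)ᶜ :=
    (dependsOn_sumOut hA).mono fun v hv => hv.1
  have h3 : sumOut {γ, δ} (partialProd t k) = fun i => sumOut {δ} A i * sumOut {γ} B i := by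
    rw [Finset.insert_eq, sumOut_union (by simpa using hne), h2, ← sumOut_mul_left hdA]
    exact congrArg _ (funext fun i => mul_comm _ _)
  rw [h1, h2, h3]
  simp only [hAB]
  ring

end Graph

/-! ### The parametrization by conditional probabilities -/

section Simplex

variable {A : Type*} [Fintype A] [DecidableEq A] {a₀ : A}

theorem sum_subtype_ne_add (a₀ : A) (f : A → ℝ) :
    ∑ b : {a : A // a ≠ a₀}, f b + f a₀ = ∑ a, f a := by
  rw [← Finset.sum_erase_add Finset.univ f (Finset.mem_univ a₀)]
  congr 1
  exact (Finset.sum_subtype _ (by simp) f).symm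

theorem prod_subtype_ne_mul (a₀ : A) (f : A → ℝ) :
    (∏ b : {a : A // a ≠ a₀}, f b) * f a₀ = ∏ a, f a := by
  rw [← Finset.prod_erase_mul Finset.univ f (Finset.mem_univ a₀)]
  congr 1
  exact (Finset.prod_subtype _ (by simp) f).symm

theorem fullProb_base (x : {a : A // a ≠ a₀} → ℝ) : fullProb a₀ x a₀ = 1 - ∑ b, x b := by
  simp [fullProb]

theorem fullProb_coe (x : {a : A // a ≠ a₀} → ℝ) (b : {a : A // a ≠ a₀}) :
    fullProb a₀ x b = x b := by
  simp [fullProb, b.2]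

theorem sum_fullProb (x : {a : A // a ≠ a₀} → ℝ) : ∑ a, fullProb a₀ x a = 1 := by
  rw [← sum_subtype_ne_add a₀]
  simp only [fullProb_coe, fullProb_base]
  ring

theorem mem_openSimplex_iff {x : {a : A // a ≠ a₀} → ℝ} :
    x ∈ openSimplex a₀ ↔ ∀ a, 0 < fullProb a₀ x a := by
  refine ⟨fun h a => ?_, fun h => ⟨fun b => ?_, ?_⟩⟩
  · by_cases ha : a = a₀
    · subst ha
      rw [fullProb_base]
      linarith [h.2]
    · exact (fullProb_coe x ⟨a, ha⟩).symm ▸ h.1 ⟨a, ha⟩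
  · exact fullProb_coe x b ▸ h b
  · have := h a₀
    rw [fullProb_base] at this
    linarith

theorem fullProb_restrict {y : A → ℝ} (hy : ∑ a, y a = 1) (a : A) :
    fullProb a₀ (fun b => y b) a = y a := by
  by_cases ha : a = a₀
  · subst ha
    rw [fullProb_base, ← hy, ← sum_subtype_ne_add a]
    ring
  · exact fullProb_coe (fun b : {a : A // a ≠ a₀} => y b) ⟨a, ha⟩

theorem continuous_fullProb (a : A) : Continuous fun x => fullProb a₀ x a := by
  unfold fullProb
  split_ifs <;> fun_prop

theorem isOpen_openSimplex (a₀ : A) : IsOpen (openSimplex a₀) := by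
  have : openSimplex a₀ = ⋂ a, {x | 0 < fullProb a₀ x a} := by
    ext x
    simp [mem_openSimplex_iff]
  rw [this]
  exact isOpen_iInter_of_finite fun a => isOpen_lt continuous_const (continuous_fullProb a)

theorem openSimplex_nonempty (a₀ : A) : (openSimplex a₀).Nonempty := by
  have hA : (0 : ℝ) < Fintype.card A := by
    exact_mod_cast Fintype.card_pos_iff.2 ⟨a₀⟩
  refine ⟨fun b => (fun _ : A => (Fintype.card A : ℝ)⁻¹) b, mem_openSimplex_iff.2 fun a => ?_⟩
  rw [fullProb_restrict (y := fun _ : A => (Fintype.card A : ℝ)⁻¹) (by simp [hA.ne'])]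
  positivity

end Simplex

section Graph

variable {V : Type*} [Fintype V] [DecidableEq V] {k : ℕ} {Lv : V → Type*} [∀ v, Fintype (Lv v)]
  [∀ v, DecidableEq (Lv v)] {C : Fin k → Finset V} {base : ∀ v, Lv v}

/-- The conditional probability, under `η`, of the value of `i` on the residual of `C l` given its
value on the separator, as a function of the cell `i`. -/
def factor (C : Fin k → Finset V) (base : ∀ v, Lv v) (η : Param C base) (l : Fin k)
    (i : ∀ v, Lv v) : ℝ :=
  groupProb C base η ⟨l, (sep C l).restrict i⟩ ((res C l).restrict i)

theorem isKernelFamily_factor (C : Fin k → Finset V) (base : ∀ v, Lv v) (η : Param C base) :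
    IsKernelFamily C (factor C base η) where
  dependsOn l i j h := by
    have h1 : (sep C l).restrict i = (sep C l).restrict j :=
      funext fun v => h v (mem_sep.1 v.2).2
    have h2 : (res C l).restrict i = (res C l).restrict j :=
      funext fun v => h v (mem_res.1 v.2).2
    rw [factor, h1, h2, factor]
  sumOut_res l := by
    funext i
    rw [sumOut_eq_sum (f := factor C base η l) (disjoint_sep_res C l)
      (fun s r => groupProb C base η ⟨l, s⟩ r) fun i => rfl]
    exact sum_fullProb _

omit [Fintype V] in
theorem cellProb_eq_partialProd (η : Param C base) :
    cellProb C base η = partialProd (factor C base η) k := by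
  funext i
  rw [partialProd_eq_prod]
  rfl

omit [Fintype V] in
theorem groupProb_pos {η : Param C base} (hη : η ∈ paramSpace C base) (j : Group Lv C)
    (r : Cell C j) : 0 < groupProb C base η j r :=
  mem_openSimplex_iff.1 (hη j trivial) r

omit [Fintype V] in
theorem factor_pos {η : Param C base} (hη : η ∈ paramSpace C base) (l : Fin k) (i : ∀ v, Lv v) :
    0 < factor C base η l i :=
  groupProb_pos hη _ _

omit [Fintype V] in
theorem cellProb_pos {η : Param C base} (hη : η ∈ paramSpace C base) (i : ∀ v, Lv v) :
    0 < cellProb C base η i :=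
  Finset.prod_pos fun l _ => factor_pos hη l i

theorem sum_condProb {p : (∀ v, Lv v) → ℝ} {R S : Finset V} {s : ∀ v : S, Lv v}
    (hs : marginal p S s ≠ 0) : ∑ r, condProb p R S s r = 1 := by
  simp only [condProb]
  rw [← Finset.sum_div, sum_sliceEntry]
  exact div_self hs

theorem groupProb_pcond {p : (∀ v, Lv v) → ℝ} (hp : ∀ i, 0 < p i) (j : Group Lv C)
    (r : Cell C j) :
    groupProb C base (pcond C base p) j r = condProb p (res C j.1) (sep C j.1) j.2 r := by
  refine fullProb_restrict (y := condProb p (res C j.1) (sep C j.1) j.2) (sum_condProb ?_) r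
  obtain ⟨i, hi, -⟩ := exists_restrict_eq (disjoint_sep_res C j.1) base j.2 r
  rw [← hi, marginal_restrict]
  exact (sumOut_pos hp i).ne'

theorem pcond_mem_paramSpace {p : (∀ v, Lv v) → ℝ} (hp : ∀ i, 0 < p i) :
    pcond C base p ∈ paramSpace C base := by
  intro j _
  refine mem_openSimplex_iff.2 fun r => ?_
  have := groupProb_pcond (base := base) hp j r
  rw [groupProb] at this
  rw [this]
  obtain ⟨i, hi, hr⟩ := exists_restrict_eq (disjoint_sep_res C j.1) base j.2 r
  rw [← hi, ← hr, condProb, sliceEntry_restrict, marginal_restrict]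
  exact div_pos (sumOut_pos hp i) (sumOut_pos hp i)

variable {G : SimpleGraph V}

theorem cellProb_pcond (hC : IsPerfectCliqueOrdering G C) {p : (∀ v, Lv v) → ℝ}
    (hp : p ∈ markovModel G) : cellProb C base (pcond C base p) = p := by
  obtain ⟨t, ht, rfl⟩ := exists_isKernelFamily hC base hp
  funext i
  rw [partialProd_eq_prod]
  refine Finset.prod_congr rfl fun l _ => ?_
  rw [groupProb_pcond hp.1]
  exact ht.condProb_restrict hC.initialUnion_eq_univ hp.1 l i

theorem cellProb_mem_markovModel (hC : IsPerfectCliqueOrdering G C) {η : Param C base}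
    (hη : η ∈ paramSpace C base) : cellProb C base η ∈ markovModel G := by
  have : Nonempty (∀ v, Lv v) := ⟨base⟩
  have hpos := cellProb_pos hη
  rw [cellProb_eq_partialProd] at hpos ⊢
  exact partialProd_mem_markovModel hC (isKernelFamily_factor C base η) hpos

theorem pcond_cellProb (hC : IsPerfectCliqueOrdering G C) {η : Param C base}
    (hη : η ∈ paramSpace C base) : pcond C base (cellProb C base η) = η := by
  funext j r
  obtain ⟨i, hi, hr⟩ := exists_restrict_eq (disjoint_sep_res C j.1) base j.2 r.1
  have hpos := cellProb_pos hη
  rw [cellProb_eq_partialProd] at hpos ⊢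
  have := (isKernelFamily_factor C base η).condProb_restrict hC.initialUnion_eq_univ hpos j.1 i
  rw [factor, hi, hr] at this
  rw [pcond, this]
  exact fullProb_coe _ _

end Graph

/-! ### Fisher information of multinomial models -/

section Multinomial

variable {A : Type*} [Fintype A] [DecidableEq A]

omit [DecidableEq A] in
theorem multinomialProb_mul (p w : A → ℝ) (n : A → ℕ) :
    multinomialProb (fun a => p a * w a) n = multinomialProb p n * ∏ a, w a ^ n a := by
  simp only [multinomialProb, mul_pow, Finset.prod_mul_distrib]
  ring

omit [DecidableEq A] in
theorem multinomialProb_pos {p : A → ℝ} (hp : ∀ a, 0 < p a) (n : A → ℕ) :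
    0 < multinomialProb p n :=
  mul_pos (by exact_mod_cast Nat.multinomial_pos _ _)
    (Finset.prod_pos fun a _ => pow_pos (hp a) _)

omit [DecidableEq A] in
theorem multinomialProb_exp (p u : A → ℝ) (s : ℝ) (n : A → ℕ) :
    multinomialProb (fun a => p a * Real.exp (s * u a)) n =
      multinomialProb p n * Real.exp (s * ∑ a, n a * u a) := by
  rw [multinomialProb_mul, Finset.mul_sum, Real.exp_sum]
  congr 1
  refine Finset.prod_congr rfl fun a _ => ?_
  rw [← Real.exp_nat_mul]
  ring_nf

theorem sum_multinomialProb (p : A → ℝ) (N : ℕ) :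
    ∑ n ∈ countTables A N, multinomialProb p n = (∑ a, p a) ^ N :=
  (Finset.sum_pow_eq_sum_piAntidiag _ _ _).symm

theorem hasDerivAt_mul_exp (c u t : ℝ) :
    HasDerivAt (fun s => c * Real.exp (s * u)) (c * Real.exp (t * u) * u) t := by
  have := (((hasDerivAt_id t).mul_const u).exp).const_mul c
  simpa [mul_assoc] using this

/-- The first moments, from the derivative of the exponentially tilted multinomial theorem. -/
theorem sum_multinomialProb_mul (p v : A → ℝ) (N : ℕ) :
    ∑ n ∈ countTables A N, multinomialProb p n * ∑ a, n a * v a =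
      N * (∑ a, p a) ^ (N - 1) * ∑ a, p a * v a := by
  have h1 : HasDerivAt (fun s : ℝ => ∑ n ∈ countTables A N,
      multinomialProb p n * Real.exp (s * ∑ a, n a * v a))
      (∑ n ∈ countTables A N, multinomialProb p n * Real.exp (0 * ∑ a, n a * v a) *
        ∑ a, n a * v a) 0 :=
    HasDerivAt.fun_sum fun n _ => hasDerivAt_mul_exp _ _ _
  have h2 : HasDerivAt (fun s : ℝ => (∑ a, p a * Real.exp (s * v a)) ^ N)
      (N * (∑ a, p a * Real.exp (0 * v a)) ^ (N - 1) *
        ∑ a, p a * Real.exp (0 * v a) * v a) 0 :=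
    HasDerivAt.fun_pow (HasDerivAt.fun_sum fun a _ => hasDerivAt_mul_exp _ _ _) N
  have h3 : (fun s : ℝ => ∑ n ∈ countTables A N,
      multinomialProb p n * Real.exp (s * ∑ a, n a * v a)) =
      fun s : ℝ => (∑ a, p a * Real.exp (s * v a)) ^ N := by
    funext s
    rw [← sum_multinomialProb]
    exact Finset.sum_congr rfl fun n _ => (multinomialProb_exp p v s n).symm
  rw [h3] at h1
  simpa using h1.unique h2

/-- The second moments of centred linear statistics, from the derivative of the tilted first
moments. -/
theorem sum_multinomialProb_mul_mul {p u : A → ℝ} (v : A → ℝ) (N : ℕ) (hp : ∑ a, p a = 1)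
    (hu : ∑ a, p a * u a = 0) :
    ∑ n ∈ countTables A N, multinomialProb p n * ((∑ a, n a * u a) * ∑ a, n a * v a) =
      N * ∑ a, p a * (u a * v a) := by
  have h1 : HasDerivAt (fun s : ℝ => ∑ n ∈ countTables A N,
      (multinomialProb p n * ∑ a, n a * v a) * Real.exp (s * ∑ a, n a * u a))
      (∑ n ∈ countTables A N, (multinomialProb p n * ∑ a, n a * v a) *
        Real.exp (0 * ∑ a, n a * u a) * ∑ a, n a * u a) 0 :=
    HasDerivAt.fun_sum fun n _ => hasDerivAt_mul_exp _ _ _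
  have h2 : HasDerivAt (fun s : ℝ => (∑ a, p a * Real.exp (s * u a)) ^ (N - 1))
      ((N - 1 : ℕ) * (∑ a, p a * Real.exp (0 * u a)) ^ (N - 1 - 1) *
        ∑ a, p a * Real.exp (0 * u a) * u a) 0 :=
    HasDerivAt.fun_pow (HasDerivAt.fun_sum fun a _ => hasDerivAt_mul_exp _ _ _) (N - 1)
  have h3 : HasDerivAt (fun s : ℝ => ∑ a, (p a * v a) * Real.exp (s * u a))
      (∑ a, (p a * v a) * Real.exp (0 * u a) * u a) 0 :=
    HasDerivAt.fun_sum fun a _ => hasDerivAt_mul_exp _ _ _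
  have h4 := (h2.mul h3).const_mul (N : ℝ)
  have h5 : (fun s : ℝ => ∑ n ∈ countTables A N,
      (multinomialProb p n * ∑ a, n a * v a) * Real.exp (s * ∑ a, n a * u a)) =
      fun s : ℝ => (N : ℝ) * ((fun s : ℝ => (∑ a, p a * Real.exp (s * u a)) ^ (N - 1)) *
        fun s : ℝ => ∑ a, (p a * v a) * Real.exp (s * u a)) s := by
    funext s
    have := sum_multinomialProb_mul (fun a => p a * Real.exp (s * u a)) v N
    simp only [multinomialProb_exp] at this
    simp only [Pi.mul_apply]
    rw [← mul_assoc]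
    convert this using 1
    · exact Finset.sum_congr rfl fun n _ => by ring
    · congr 1
      exact Finset.sum_congr rfl fun n _ => by ring
  rw [h5] at h1
  have := h1.unique h4
  simp only [zero_mul, Real.exp_zero, mul_one, hu, mul_zero, zero_add, hp, one_pow, one_mul]
    at this
  convert this using 1
  · exact Finset.sum_congr rfl fun n _ => by ring
  · congr 1
    exact Finset.sum_congr rfl fun n _ => by ring

omit [DecidableEq A] in
theorem hasDerivAt_log_multinomialProb {p : A → ℝ} (hp : ∀ a, 0 < p a) (u : A → ℝ) (n : A → ℕ) :
    HasDerivAt (fun t : ℝ => Real.log (multinomialProb (fun a => p a * (1 + t * u a)) n))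
      (∑ a, n a * u a) 0 := by
  have hlin : ∀ a, HasDerivAt (fun t : ℝ => 1 + t * u a) (u a) 0 := fun a => by
    simpa using ((hasDerivAt_id (0 : ℝ)).mul_const (u a)).const_add 1
  have hev : ∀ᶠ t in nhds (0 : ℝ), ∀ a, 0 < 1 + t * u a :=
    Filter.eventually_all.2 fun a => (hlin a).continuousAt.eventually_const_lt (by simp)
  have hd : HasDerivAt (fun t : ℝ => Real.log (multinomialProb p n) +
      ∑ a, n a * Real.log (1 + t * u a)) (∑ a, n a * u a) 0 := by
    refine (HasDerivAt.fun_sum fun a _ => ?_).const_add _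
    have := ((hlin a).log (by simp)).const_mul (n a : ℝ)
    simpa using this
  refine hd.congr_of_eventuallyEq ?_
  filter_upwards [hev] with t ht
  rw [multinomialProb_mul, Real.log_mul (multinomialProb_pos hp n).ne'
    (Finset.prod_ne_zero_iff.2 fun a _ => (pow_pos (ht a) _).ne'),
    Real.log_prod fun a _ => (pow_pos (ht a) _).ne']
  simp

/-- The information matrix of a multinomial model whose cell probabilities `q` are affine along
each coordinate line through `θ`; `u a` is the score of a single observation in the direction
`b a`. -/
theorem fisherInfo_multinomial {E ι : Type*} [AddCommGroup E] [Module ℝ E] (b : ι → E)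
    {q : E → A → ℝ} {θ : E} (u : ι → A → ℝ) (N : ℕ) (hpos : ∀ i, 0 < q θ i)
    (hsum : ∑ i, q θ i = 1) (hu : ∀ a, ∑ i, q θ i * u a i = 0)
    (hq : ∀ a (t : ℝ), q (θ + t • b a) = fun i => q θ i * (1 + t * u a i)) :
    fisherInfo b (countTables A N) (fun η => multinomialProb (q η)) θ =
      Matrix.of fun a c => N * ∑ i, q θ i * (u a i * u c i) := by
  have hscore : ∀ a n, lineDeriv ℝ (fun η => Real.log (multinomialProb (q η) n)) θ (b a) =
      ∑ i, n i * u a i := fun a n => by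
    rw [lineDeriv]
    simp only [hq]
    exact (hasDerivAt_log_multinomialProb hpos (u a) n).deriv
  ext a c
  simp only [fisherInfo, hscore, Matrix.of_apply]
  exact sum_multinomialProb_mul_mul (u c) N hsum (hu a)

end Multinomial

section Simplex

variable {A : Type*} [Fintype A] [DecidableEq A] {a₀ : A}

/-- The derivative of the full probability vector with respect to its free coordinate `d`. -/
def fullDir (a₀ : A) (d : {a : A // a ≠ a₀}) (a : A) : ℝ :=
  if a = d then 1 else if a = a₀ then -1 else 0

omit [Fintype A] in
theorem fullDir_coe (d b : {a : A // a ≠ a₀}) :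
    fullDir a₀ d b = (Pi.single d 1 : {a : A // a ≠ a₀} → ℝ) b := by
  simp [fullDir, b.2, Pi.single_apply, Subtype.ext_iff]

omit [Fintype A] in
theorem fullDir_base (d : {a : A // a ≠ a₀}) : fullDir a₀ d a₀ = -1 := by
  simp [fullDir, d.2.symm]

theorem sum_fullDir (d : {a : A // a ≠ a₀}) : ∑ a, fullDir a₀ d a = 0 := by
  rw [← sum_subtype_ne_add a₀]
  simp [fullDir_coe, fullDir_base]

theorem fullProb_add_smul_single (x : {a : A // a ≠ a₀} → ℝ) (t : ℝ) (d : {a : A // a ≠ a₀})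
    (a : A) : fullProb a₀ (x + t • Pi.single d 1) a = fullProb a₀ x a + t * fullDir a₀ d a := by
  by_cases ha : a = a₀
  · subst ha
    rw [fullProb_base, fullProb_base, fullDir_base]
    simp only [Pi.add_apply, Pi.smul_apply, smul_eq_mul, Finset.sum_add_distrib,
      ← Finset.mul_sum]
    simp
    ring
  · have h1 := fullProb_coe (x + t • Pi.single d 1) ⟨a, ha⟩
    have h2 := fullProb_coe x ⟨a, ha⟩
    have h3 := fullDir_coe d ⟨a, ha⟩
    simp only at h1 h2 h3
    rw [h1, h2, h3]
    simp

/-- The information matrix of a single multinomial observation, in the free coordinates. -/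
noncomputable def simplexInfo (a₀ : A) (x : {a : A // a ≠ a₀} → ℝ) :
    Matrix {a : A // a ≠ a₀} {a : A // a ≠ a₀} ℝ :=
  Matrix.of fun d e => ∑ a, fullDir a₀ d a * fullDir a₀ e a / fullProb a₀ x a

/-- The information matrix is a diagonal matrix plus a matrix of rank one. -/
theorem det_simplexInfo {x : {a : A // a ≠ a₀} → ℝ} (hx : x ∈ openSimplex a₀) :
    (simplexInfo a₀ x).det = ∏ a, (fullProb a₀ x a)⁻¹ := by
  have hpos := mem_openSimplex_iff.1 hx
  set D : Matrix {a : A // a ≠ a₀} {a : A // a ≠ a₀} ℝ := Matrix.diagonal fun d => (x d)⁻¹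
  set U : Matrix {a : A // a ≠ a₀} Unit ℝ := Matrix.of fun d _ => x d
  set W : Matrix Unit {a : A // a ≠ a₀} ℝ := Matrix.of fun _ _ => (fullProb a₀ x a₀)⁻¹
  have hfac : simplexInfo a₀ x = D * (1 + U * W) := by
    ext d e
    rw [Matrix.diagonal_mul]
    simp only [simplexInfo, Matrix.of_apply, Matrix.add_apply,
      Matrix.mul_apply, U, W, Finset.univ_unique, Finset.sum_singleton, Matrix.one_apply]
    rw [← sum_subtype_ne_add a₀]
    simp only [fullDir_coe, fullDir_base, fullProb_coe]
    have hxd : x d ≠ 0 := (hx.1 d).ne'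
    rw [Finset.sum_eq_single d (fun b _ hb => by simp [hb]) (by simp)]
    have h0 : fullProb a₀ x a₀ ≠ 0 := (hpos a₀).ne'
    by_cases hde : d = e
    · subst hde
      simp
      field_simp
    · simp [hde]
      field_simp
  have hprod : ∏ a, (fullProb a₀ x a)⁻¹ = (∏ d, (x d)⁻¹) * (fullProb a₀ x a₀)⁻¹ := by
    rw [← prod_subtype_ne_mul a₀]
    simp only [fullProb_coe]
  rw [hfac, Matrix.det_mul, Matrix.det_one_add_mul_comm, Matrix.det_diagonal, hprod]
  congr 1
  have h0 : fullProb a₀ x a₀ ≠ 0 := (hpos a₀).ne'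
  have h1 : ∑ b, x b = 1 - fullProb a₀ x a₀ := by
    rw [fullProb_base]
    ring
  simp only [Matrix.det_unique, Matrix.add_apply, Matrix.one_apply_eq, Matrix.mul_apply,
    Matrix.of_apply, U, W, ← Finset.mul_sum, h1]
  field_simp
  ring

theorem jeffreysMultinomial_eq {x : {a : A // a ≠ a₀} → ℝ} (hx : x ∈ openSimplex a₀) (M : ℕ) :
    jeffreysMultinomial a₀ M x =
      Real.sqrt ((M : ℝ) ^ Fintype.card {a : A // a ≠ a₀} * ∏ a, (fullProb a₀ x a)⁻¹) := by
  have hpos := mem_openSimplex_iff.1 hx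
  have hmul : ∀ (d : {a : A // a ≠ a₀}) a,
      fullProb a₀ x a * (fullDir a₀ d a / fullProb a₀ x a) = fullDir a₀ d a := fun d a =>
    mul_div_cancel₀ _ (hpos a).ne'
  have hI := fisherInfo_multinomial (q := fullProb a₀) (θ := x)
    (fun a : {a : A // a ≠ a₀} => (Pi.single a 1 : {a : A // a ≠ a₀} → ℝ))
    (fun d a => fullDir a₀ d a / fullProb a₀ x a) M hpos (sum_fullProb x)
    (fun d => by simp only [hmul, sum_fullDir])
    (fun d t => by
      funext a
      rw [fullProb_add_smul_single, mul_add, mul_one, mul_left_comm, hmul])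
  have hI' : fisherInfo (fun a : {a : A // a ≠ a₀} => (Pi.single a 1 : {a : A // a ≠ a₀} → ℝ))
      (countTables A M) (fun y => multinomialProb (fullProb a₀ y)) x =
      (M : ℝ) • simplexInfo a₀ x := by
    rw [hI]
    ext d e
    simp only [simplexInfo, Matrix.of_apply, Matrix.smul_apply, smul_eq_mul]
    congr 1
    refine Finset.sum_congr rfl fun a _ => ?_
    rw [← mul_assoc, hmul, mul_div_assoc]
  rw [jeffreysMultinomial, hI', Matrix.det_smul, det_simplexInfo hx]

end Simplex

/-! ### The information matrix of `p^cond` -/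

section BlockDiagonal

variable {J : Type*} [Fintype J] [DecidableEq J] {D : J → Type*} [∀ j, Fintype (D j)]
  [∀ j, DecidableEq (D j)]

/-- For a block diagonal information matrix, `h_j` is the block of the group `j`. -/
theorem hDet_blockDiagonal' (M : ∀ j, Matrix (D j) (D j) ℝ) (hM : ∀ j, (M j).det ≠ 0)
    {later : List J} {j : J} (hj : j ∉ later) :
    hDet (Matrix.blockDiagonal' M) later j = (M j).det := by
  have hmul : (Matrix.blockDiagonal' fun j => (M j)⁻¹) * Matrix.blockDiagonal' M = 1 := by
    rw [← Matrix.blockDiagonal'_mul, ← Matrix.blockDiagonal'_one]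
    congr 1
    funext j
    exact Matrix.nonsing_inv_mul _ (isUnit_iff_ne_zero.2 (hM j))
  have hQ : (Matrix.blockDiagonal' M)⁻¹ = Matrix.blockDiagonal' fun j => (M j)⁻¹ :=
    Matrix.inv_eq_left_inv hmul
  have hS : (((Matrix.blockDiagonal' M)⁻¹.submatrix Subtype.val Subtype.val :
      Matrix {a : Σ j, D j // a.1 ∉ later} {a : Σ j, D j // a.1 ∉ later} ℝ))⁻¹ =
      (Matrix.blockDiagonal' M).submatrix Subtype.val Subtype.val := by
    refine Matrix.inv_eq_right_inv ?_
    rw [hQ]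
    ext a b
    have h := congrFun (congrFun hmul a.1) b.1
    rw [Matrix.mul_apply] at h
    rw [Matrix.mul_apply]
    simp only [Matrix.submatrix_apply]
    have h1 : (1 : Matrix {a : Σ j, D j // a.1 ∉ later} {a : Σ j, D j // a.1 ∉ later} ℝ) a b =
        (1 : Matrix (Σ j, D j) (Σ j, D j) ℝ) a.1 b.1 := by
      simp [Matrix.one_apply, Subtype.ext_iff]
    rw [h1, ← h]
    refine (Finset.sum_subtype (Finset.univ.filter fun c : Σ j, D j => c.1 ∉ later) (by simp)
      (fun c : Σ j, D j => Matrix.blockDiagonal' (fun j => (M j)⁻¹) a.1 c *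
        Matrix.blockDiagonal' M c b.1)).symm.trans (Finset.sum_filter_of_ne fun c _ hc => ?_)
    obtain ⟨⟨i, d⟩, hi⟩ := a
    obtain ⟨i', d'⟩ := c
    by_cases hii : i = i'
    · exact hii ▸ hi
    · exact absurd (by rw [Matrix.blockDiagonal'_apply_ne _ _ _ hii, zero_mul]) hc
  unfold hDet
  simp only
  rw [hS]
  let e : D j ≃ {a : {a : Σ j, D j // a.1 ∉ later} // a.1.1 = j} :=
    Equiv.ofBijective (fun d => ⟨⟨⟨j, d⟩, hj⟩, rfl⟩) ⟨fun d d' h => by simpa using h, by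
      rintro ⟨⟨⟨i, d⟩, hi⟩, rfl⟩
      exact ⟨d, rfl⟩⟩
  rw [← Matrix.det_submatrix_equiv_self e]
  congr 1
  ext d d'
  exact Matrix.blockDiagonal'_apply_eq M j d d'

end BlockDiagonal

section Graph

variable {V : Type*} [Fintype V] [DecidableEq V] {k : ℕ} {Lv : V → Type*} [∀ v, Fintype (Lv v)]
  [∀ v, DecidableEq (Lv v)] {C : Fin k → Finset V} {base : ∀ v, Lv v}

/-- The score of a single observation `i` for the coordinate `a` of `p^cond`. -/
noncomputable def score (C : Fin k → Finset V) (base : ∀ v, Lv v) (η : Param C base)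
    (a : Σ j, Coord C base j) (i : ∀ v, Lv v) : ℝ :=
  if (sep C a.1.1).restrict i = a.1.2 then
    fullDir (baseCell C base a.1) a.2 ((res C a.1.1).restrict i) /
      groupProb C base η a.1 ((res C a.1.1).restrict i)
  else 0

omit [Fintype V] in
theorem groupProb_add_smul_self (η : Param C base) (j : Group Lv C) (d : Coord C base j) (t : ℝ)
    (r : Cell C j) :
    groupProb C base (η + t • coordVec ⟨j, d⟩) j r =
      groupProb C base η j r + t * fullDir (baseCell C base j) d r := by
  have : (η + t • coordVec ⟨j, d⟩) j = η j + t • Pi.single d 1 := by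
    simp [coordVec]
  rw [groupProb, this, fullProb_add_smul_single, groupProb]

omit [Fintype V] in
theorem groupProb_add_smul_of_ne (η : Param C base) {j j' : Group Lv C} (h : j' ≠ j)
    (d : Coord C base j) (t : ℝ) (r : Cell C j') :
    groupProb C base (η + t • coordVec ⟨j, d⟩) j' r = groupProb C base η j' r := by
  have : (η + t • coordVec ⟨j, d⟩) j' = η j' := by
    simp [coordVec, h]
  rw [groupProb, this, groupProb]

omit [Fintype V] in
theorem cellProb_add_smul {η : Param C base} (hη : η ∈ paramSpace C base)
    (a : Σ j, Coord C base j) (t : ℝ) :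
    cellProb C base (η + t • coordVec a) =
      fun i => cellProb C base η i * (1 + t * score C base η a i) := by
  funext i
  obtain ⟨⟨l, s⟩, d⟩ := a
  set v : Param C base := coordVec (⟨⟨l, s⟩, d⟩ : Σ j, Coord C base j) with hv
  have key : ∀ m, factor C base (η + t • v) m i =
      factor C base η m i * if m = l then 1 + t * score C base η ⟨⟨l, s⟩, d⟩ i else 1 := by
    intro m
    by_cases hm : m = l
    · subst hm
      rw [if_pos rfl]
      by_cases hs : (sep C m).restrict i = s
      · subst hs
        rw [factor, groupProb_add_smul_self, score, if_pos rfl, factor]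
        have := (groupProb_pos hη ⟨m, (sep C m).restrict i⟩ ((res C m).restrict i)).ne'
        field_simp
      · rw [factor, groupProb_add_smul_of_ne, score, if_neg hs, factor]
        · ring
        · intro h
          simp only [Sigma.mk.injEq, heq_eq_eq, true_and] at h
          exact hs h
    · rw [if_neg hm, factor, groupProb_add_smul_of_ne, mul_one, factor]
      intro h
      exact hm (congrArg Sigma.fst h)
  change ∏ m, factor C base (η + t • v) m i = (∏ m, factor C base η m i) * _
  simp only [key, Finset.prod_mul_distrib, Finset.prod_ite_eq', Finset.mem_univ, if_true]

omit [Fintype V] in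
theorem factor_mul_score {η : Param C base} (hη : η ∈ paramSpace C base)
    (j : Group Lv C) (d : Coord C base j) (i : ∀ v, Lv v) :
    factor C base η j.1 i * score C base η ⟨j, d⟩ i =
      if (sep C j.1).restrict i = j.2 then
        fullDir (baseCell C base j) d ((res C j.1).restrict i) else 0 := by
  obtain ⟨l, s⟩ := j
  rw [score]
  simp only
  split_ifs with hs
  · subst hs
    exact mul_div_cancel₀ _ (factor_pos hη l i).ne'
  · simp

omit [Fintype V] in
theorem dependsOn_score (η : Param C base) (a : Σ j, Coord C base j) :
    DependsOn (score C base η a) (C a.1.1 : Set V) := by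
  intro i j h
  have h1 : (sep C a.1.1).restrict i = (sep C a.1.1).restrict j :=
    funext fun v => h v (mem_sep.1 v.2).2
  have h2 : (res C a.1.1).restrict i = (res C a.1.1).restrict j :=
    funext fun v => h v (mem_res.1 v.2).2
  simp only [score, h1, h2]

/-- Given the preceding cliques, the score of a group has conditional expectation zero. -/
theorem sumOut_factor_mul_score {η : Param C base} (hη : η ∈ paramSpace C base)
    (a : Σ j, Coord C base j) :
    sumOut (res C a.1.1) (fun i => factor C base η a.1.1 i * score C base η a i) = fun _ => 0 := by
  obtain ⟨j, d⟩ := a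
  funext i
  rw [sumOut_eq_sum (disjoint_sep_res C j.1)
    (fun s r => if s = j.2 then fullDir (baseCell C base j) d r else 0)
    fun i => factor_mul_score hη j d i]
  split_ifs
  · exact sum_fullDir d
  · simp

omit [Fintype V] in
theorem subset_initialUnion {l m : Fin k} (h : l ≤ m) :
    (C l : Set V) ⊆ (initialUnion C (m + 1) : Set V) := fun _ hv =>
  mem_initialUnion.2 ⟨l, Nat.lt_succ_of_le h, hv⟩

theorem sum_cellProb_mul_score {η : Param C base} (hη : η ∈ paramSpace C base)
    (hC : initialUnion C k = Finset.univ) (a : Σ j, Coord C base j) :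
    ∑ i, cellProb C base η i * score C base η a i = 0 := by
  rw [cellProb_eq_partialProd, (isKernelFamily_factor C base η).sum_mul_eq hC a.1.1
    ((dependsOn_score η a).mono (subset_initialUnion le_rfl)), sumOut_factor_mul_score hη]
  simp

/-- Scores of groups belonging to different cliques are uncorrelated. -/
theorem sum_cellProb_mul_score_of_lt {η : Param C base} (hη : η ∈ paramSpace C base)
    (hC : initialUnion C k = Finset.univ) {a c : Σ j, Coord C base j} (hac : a.1.1 < c.1.1) :
    ∑ i, cellProb C base η i * (score C base η a i * score C base η c i) = 0 := by
  have hdep : DependsOn (fun i => score C base η a i * score C base η c i)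
      (initialUnion C (c.1.1 + 1) : Set V) := fun i j h => by
    simp only
    rw [dependsOn_score η a fun v hv => h v (subset_initialUnion hac.le hv),
      dependsOn_score η c fun v hv => h v (subset_initialUnion le_rfl hv)]
  have ha : DependsOn (score C base η a) ((res C c.1.1 : Set V)ᶜ) :=
    (dependsOn_score η a).mono fun v hv h => (mem_res.1 h).1 (mem_initialUnion.2 ⟨_, hac, hv⟩)
  rw [cellProb_eq_partialProd, (isKernelFamily_factor C base η).sum_mul_eq hC c.1.1 hdep]
  simp only [mul_left_comm (factor C base η _ _)]
  rw [sumOut_mul_left ha, sumOut_factor_mul_score hη]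
  simp

theorem sum_cellProb_mul_score_of_ne {η : Param C base} (hη : η ∈ paramSpace C base)
    (hC : initialUnion C k = Finset.univ) {a c : Σ j, Coord C base j} (hac : a.1 ≠ c.1) :
    ∑ i, cellProb C base η i * (score C base η a i * score C base η c i) = 0 := by
  rcases lt_trichotomy a.1.1 c.1.1 with h | h | h
  · exact sum_cellProb_mul_score_of_lt hη hC h
  · refine Finset.sum_eq_zero fun i _ => ?_
    obtain ⟨⟨l, s⟩, d⟩ := a
    obtain ⟨⟨l', s'⟩, d'⟩ := c
    simp only at h
    subst h
    simp only [score]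
    by_cases h1 : (sep C l).restrict i = s
    · by_cases h2 : (sep C l).restrict i = s'
      · exact absurd (by rw [← h1, ← h2]) hac
      · simp [h2]
    · simp [h1]
  · simp only [mul_comm (score C base η a _)]
    exact sum_cellProb_mul_score_of_lt hη hC h

theorem sum_cellProb_mul_score_self {η : Param C base} (hη : η ∈ paramSpace C base)
    (hC : initialUnion C k = Finset.univ) (j : Group Lv C) (d e : Coord C base j) :
    ∑ i, cellProb C base η i * (score C base η ⟨j, d⟩ i * score C base η ⟨j, e⟩ i) =
      marginal (cellProb C base η) (sep C j.1) j.2 *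
        simplexInfo (baseCell C base j) (η j) d e := by
  have hdep : DependsOn (fun i => score C base η ⟨j, d⟩ i * score C base η ⟨j, e⟩ i)
      (initialUnion C (j.1 + 1) : Set V) := fun i i' h => by
    simp only
    rw [dependsOn_score η ⟨j, d⟩ fun v hv => h v (subset_initialUnion le_rfl hv),
      dependsOn_score η ⟨j, e⟩ fun v hv => h v (subset_initialUnion le_rfl hv)]
  have hsum : ∀ i, sumOut (res C j.1) (fun i => factor C base η j.1 i *
      (score C base η ⟨j, d⟩ i * score C base η ⟨j, e⟩ i)) i =
      if (sep C j.1).restrict i = j.2 then simplexInfo (baseCell C base j) (η j) d e else 0 := by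
    intro i
    rw [sumOut_eq_sum (disjoint_sep_res C j.1) (fun s r => if s = j.2 then
      fullDir (baseCell C base j) d r * fullDir (baseCell C base j) e r /
        groupProb C base η j r else 0)]
    · split_ifs
      · rfl
      · simp
    · intro i
      rw [← mul_assoc, factor_mul_score hη, score]
      simp only
      split_ifs
      · rw [mul_div_assoc]
      · simp
  rw [cellProb_eq_partialProd, (isKernelFamily_factor C base η).sum_mul_eq hC j.1 hdep]
  simp only [hsum, mul_ite, mul_zero]
  rw [← Finset.sum_filter, ← Finset.sum_mul, marginal]

/-- The information matrix is block diagonal; the block of a group is the information matrix of a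
multinomial model whose sample size is the expected count of the cell of the separator. -/
theorem infoMatrix_eq {η : Param C base} (hη : η ∈ paramSpace C base)
    (hC : initialUnion C k = Finset.univ) (N : ℕ) :
    infoMatrix C base N η = Matrix.blockDiagonal' fun j =>
      (N * marginal (cellProb C base η) (sep C j.1) j.2) •
        simplexInfo (baseCell C base j) (η j) := by
  have hsum : ∑ i, cellProb C base η i = 1 := by
    have : Nonempty (∀ v, Lv v) := ⟨base⟩
    rw [cellProb_eq_partialProd]
    exact (isKernelFamily_factor C base η).sum_prod hC
  have := fisherInfo_multinomial (q := cellProb C base) (θ := η) coordVec (score C base η) N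
    (cellProb_pos hη) hsum (sum_cellProb_mul_score hη hC) (cellProb_add_smul hη)
  refine this.trans ?_
  ext ⟨j, d⟩ ⟨j', e⟩
  by_cases h : j = j'
  · subst h
    rw [Matrix.blockDiagonal'_apply_eq, Matrix.of_apply, sum_cellProb_mul_score_self hη hC,
      Matrix.smul_apply, smul_eq_mul, mul_assoc]
  · rw [Matrix.blockDiagonal'_apply_ne _ _ _ h, Matrix.of_apply,
      sum_cellProb_mul_score_of_ne hη hC h, mul_zero]

theorem marginal_sep_pos {η : Param C base} (hη : η ∈ paramSpace C base) (j : Group Lv C) :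
    0 < marginal (cellProb C base η) (sep C j.1) j.2 := by
  obtain ⟨i, hi, -⟩ := exists_restrict_eq (disjoint_sep_res C j.1) base j.2
    ((res C j.1).restrict base)
  rw [← hi, marginal_restrict]
  exact sumOut_pos (cellProb_pos hη) i

/-- The probability of a cell of a separator does not depend on the parameters of its group. -/
theorem marginal_sep_update (hC : initialUnion C k = Finset.univ) (η : Param C base)
    (j : Group Lv C) (x : Coord C base j → ℝ) :
    marginal (cellProb C base (Function.update η j x)) (sep C j.1) j.2 =
      marginal (cellProb C base η) (sep C j.1) j.2 := by
  obtain ⟨i, hi, -⟩ := exists_restrict_eq (disjoint_sep_res C j.1) base j.2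
    ((res C j.1).restrict base)
  rw [← hi, marginal_restrict, marginal_restrict, cellProb_eq_partialProd,
    cellProb_eq_partialProd, (isKernelFamily_factor C base _).sumOut_sep hC,
    (isKernelFamily_factor C base _).sumOut_sep hC]
  congr 1
  funext i'
  refine Finset.prod_congr rfl fun m hm => ?_
  have hne : (⟨m, (sep C m).restrict i'⟩ : Group Lv C) ≠ j := by
    rintro rfl
    simp at hm
  rw [factor, groupProb, Function.update_of_ne hne, factor, groupProb]

theorem continuous_marginal (D : Finset V) (x : ∀ v : D, Lv v) :
    Continuous fun η : Param C base => marginal (cellProb C base η) D x := by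
  refine continuous_finsetSum _ fun i _ => continuous_finsetProd _ fun l _ => ?_
  exact (continuous_fullProb _).comp (continuous_apply _)

/-- The logarithm of the product of the probabilities in the group `j` to the power `-1`. -/
noncomputable def negLogProd (C : Fin k → Finset V) (base : ∀ v, Lv v) (j : Group Lv C)
    (x : Coord C base j → ℝ) : ℝ :=
  -∑ r, Real.log (fullProb (baseCell C base j) x r)

theorem det_block_pos {η : Param C base} (hη : η ∈ paramSpace C base) {N : ℕ} (hN : 0 < N)
    (j : Group Lv C) : 0 < ((N * marginal (cellProb C base η) (sep C j.1) j.2) •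
        simplexInfo (baseCell C base j) (η j)).det := by
  rw [Matrix.det_smul, det_simplexInfo (hη j trivial)]
  have h1 := marginal_sep_pos hη j
  have h2 := mem_openSimplex_iff.1 (hη j trivial)
  have h3 : (0 : ℝ) < N := by exact_mod_cast hN
  exact mul_pos (pow_pos (mul_pos h3 h1) _) (Finset.prod_pos fun r _ => inv_pos.2 (h2 r))

theorem log_hDet_infoMatrix {η : Param C base} (hη : η ∈ paramSpace C base)
    (hC : initialUnion C k = Finset.univ) {N : ℕ} (hN : 0 < N) {later : List (Group Lv C)}
    {j : Group Lv C} (hj : j ∉ later) :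
    Real.log (hDet (infoMatrix C base N η) later j) = negLogProd C base j (η j) +
      Fintype.card (Coord C base j) *
        Real.log (N * marginal (cellProb C base η) (sep C j.1) j.2) := by
  have h1 := marginal_sep_pos hη j
  have h2 := mem_openSimplex_iff.1 (hη j trivial)
  have h3 : (0 : ℝ) < N := by exact_mod_cast hN
  rw [infoMatrix_eq hη hC, hDet_blockDiagonal' _ (fun j => (det_block_pos hη hN j).ne') hj,
    Matrix.det_smul, det_simplexInfo (hη j trivial),
    Real.log_mul (pow_pos (mul_pos h3 h1) _).ne'
      (Finset.prod_pos fun r _ => inv_pos.2 (h2 r)).ne', Real.log_pow,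
    Real.log_prod fun r _ => (inv_pos.2 (h2 r)).ne', negLogProd, add_comm]
  simp

end Graph

open MeasureTheory

/-! ### Reference priors of separable models -/

section Reference

variable {J : Type*} [Fintype J] [DecidableEq J] {D : J → Type*} [∀ j, Fintype (D j)]
  [∀ j, DecidableEq (D j)]

/-- `log |h_j|` is, for every order of the groups, the sum of a function `A j` of the parameters
of the group `j` and a function `W j` of the parameters of the other groups. -/
structure IsSeparable (Θ : ∀ j, Set (D j → ℝ))
    (Q : (∀ j, D j → ℝ) → Matrix (Σ j, D j) (Σ j, D j) ℝ) (A : ∀ j, (D j → ℝ) → ℝ)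
    (W : J → (∀ j, D j → ℝ) → ℝ) : Prop where
  log_hDet : ∀ θ ∈ Set.univ.pi Θ, ∀ (later : List J) (j : J), j ∉ later →
    Real.log (hDet (Q θ) later j) = A j (θ j) + W j θ
  update : ∀ θ j x, W j (Function.update θ j x) = W j θ
  continuousOn_right : ∀ j, ContinuousOn (W j) (Set.univ.pi Θ)
  continuousOn_left : ∀ j, ContinuousOn (A j) (Θ j)

/-- The density proportional to `exp (A / 2)` on the set `K`. -/
noncomputable def truncatedDensity {E : Type*} [MeasureSpace E] (A : E → ℝ) (K : Set E) (x : E) :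
    ℝ :=
  K.indicator (fun x => Real.exp (A x / 2) / ∫ z in K, Real.exp (A z / 2)) x

theorem truncatedDensity_of_notMem {E : Type*} [MeasureSpace E] {A : E → ℝ} {K : Set E} {x : E}
    (hx : x ∉ K) : truncatedDensity A K x = 0 :=
  Set.indicator_of_notMem hx _

section Truncated

variable {ι : Type*} [Fintype ι] {A : (ι → ℝ) → ℝ} {K : Set (ι → ℝ)}

theorem setIntegral_exp_pos (hK : IsCompact K) (hA : ContinuousOn A K) (hpos : volume K ≠ 0) :
    0 < ∫ z in K, Real.exp (A z / 2) := by
  have hcont : ContinuousOn (fun z => Real.exp (A z / 2)) K :=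
    Real.continuous_exp.comp_continuousOn (hA.div_const 2)
  rw [setIntegral_pos_iff_support_of_nonneg_ae (ae_of_all _ fun z => (Real.exp_pos _).le)
    (hcont.integrableOn_compact hK)]
  have : Function.support (fun z => Real.exp (A z / 2)) = Set.univ := by
    ext z
    simp [Real.exp_ne_zero]
  rw [this, Set.univ_inter]
  exact pos_iff_ne_zero.2 hpos

theorem integral_truncatedDensity (hK : IsCompact K) (hA : ContinuousOn A K)
    (hpos : volume K ≠ 0) : ∫ x, truncatedDensity A K x = 1 := by
  unfold truncatedDensity
  rw [integral_indicator hK.isClosed.measurableSet, integral_div]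
  exact div_self (setIntegral_exp_pos hK hA hpos).ne'

end Truncated

variable {Θ K : ∀ j, Set (D j → ℝ)}
  {Q : (∀ j, D j → ℝ) → Matrix (Σ j, D j) (Σ j, D j) ℝ} {A : ∀ j, (D j → ℝ) → ℝ}
  {W : J → (∀ j, D j → ℝ) → ℝ}

theorem condDensity_of_notMem {L : List J} {θ : ∀ j, D j → ℝ} {i : J} (hi : i ∈ L)
    (hθ : θ i ∉ K i) : condDensity Q K L θ = 0 := by
  induction L with
  | nil => simp at hi
  | cons j later ih =>
    rw [condDensity]
    rcases List.mem_cons.1 hi with rfl | h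
    · rw [Set.indicator_of_notMem hθ, zero_mul]
    · rw [ih h, mul_zero]

omit [Fintype J] [∀ j, Fintype (D j)] [∀ j, DecidableEq (D j)] in
theorem replace_of_mem (θ : ∀ j, D j → ℝ) (later : List J)
    (y : ∀ i : {i : J // i ∈ later}, D i.1 → ℝ) (i : {i : J // i ∈ later}) :
    replace θ later y i = y i := by
  simp [replace, i.2]

omit [Fintype J] [∀ j, Fintype (D j)] [∀ j, DecidableEq (D j)] in
theorem replace_of_notMem (θ : ∀ j, D j → ℝ) {later : List J}
    (y : ∀ i : {i : J // i ∈ later}, D i.1 → ℝ) {j : J} (hj : j ∉ later) :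
    replace θ later y j = θ j := by
  simp [replace, hj]

omit [Fintype J] [∀ j, Fintype (D j)] [∀ j, DecidableEq (D j)] in
theorem replace_update (θ : ∀ j, D j → ℝ) {later : List J}
    (y : ∀ i : {i : J // i ∈ later}, D i.1 → ℝ) {j : J} (hj : j ∉ later) (x : D j → ℝ) :
    replace (Function.update θ j x) later y = Function.update (replace θ later y) j x := by
  funext i
  by_cases hi : i ∈ later
  · have hij : i ≠ j := fun h => hj (h ▸ hi)
    simp [replace, hi, hij]
  · by_cases hij : i = j
    · subst hij
      simp [replace, hi]
    · simp [replace, hi, hij]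

omit [Fintype J] [∀ j, Fintype (D j)] [∀ j, DecidableEq (D j)] in
theorem replace_mem {θ : ∀ j, D j → ℝ} (hθ : θ ∈ Set.univ.pi Θ) {later : List J}
    {y : ∀ i : {i : J // i ∈ later}, D i.1 → ℝ} (hy : ∀ i, y i ∈ Θ i.1) :
    replace θ later y ∈ Set.univ.pi Θ := by
  intro j _
  by_cases hj : j ∈ later
  · exact (replace_of_mem θ later y ⟨j, hj⟩).symm ▸ hy ⟨j, hj⟩
  · exact (replace_of_notMem θ y hj).symm ▸ hθ j trivial

omit [Fintype J] [∀ j, Fintype (D j)] [∀ j, DecidableEq (D j)] in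
theorem continuous_replace (θ : ∀ j, D j → ℝ) (later : List J) :
    Continuous (replace θ later) := by
  refine continuous_pi fun j => ?_
  by_cases hj : j ∈ later
  · simp only [replace, hj, dif_pos]
    exact continuous_apply (⟨j, hj⟩ : {i : J // i ∈ later})
  · simp only [replace, hj, dif_neg, not_false_eq_true]
    exact continuous_const

omit [Fintype J] [∀ j, Fintype (D j)] [∀ j, DecidableEq (D j)] in
theorem update_mem {θ : ∀ j, D j → ℝ} (hθ : θ ∈ Set.univ.pi Θ) {j : J} {x : D j → ℝ}
    (hx : x ∈ Θ j) : Function.update θ j x ∈ Set.univ.pi Θ := by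
  intro i _
  by_cases hij : i = j
  · subst hij
    simpa using hx
  · simpa [hij] using hθ i trivial

/-- The reference density on a product of compact sets factorizes over the groups: at each step
of the algorithm the part `W j` of `log |h_j|` contributes a factor that does not depend on the
group `j`, and this factor cancels in the normalization. -/
theorem condDensity_eq_prod (hsep : IsSeparable Θ Q A W) (hK : ∀ j, IsCompact (K j))
    (hKΘ : ∀ j, K j ⊆ Θ j) (hpos : ∀ j, volume (K j) ≠ 0) {L : List J} (hL : L.Nodup)
    {θ : ∀ j, D j → ℝ} (hθ : θ ∈ Set.univ.pi Θ) :
    condDensity Q K L θ = ∏ j ∈ L.toFinset, truncatedDensity (A j) (K j) (θ j) := by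
  induction L generalizing θ with
  | nil => simp [condDensity]
  | cons j later ih =>
    obtain ⟨hj, hnd⟩ := List.nodup_cons.1 hL
    have ih' := fun θ hθ => @ih hnd θ hθ
    set ρ : (∀ i : {i : J // i ∈ later}, D i.1 → ℝ) → ℝ :=
      fun y => ∏ i, truncatedDensity (A i.1) (K i.1) (y i) with hρ
    have hAK : ∀ j, ContinuousOn (A j) (K j) := fun j =>
      (hsep.continuousOn_left j).mono (hKΘ j)
    have hρ0 : ∀ y : (∀ i : {i : J // i ∈ later}, D i.1 → ℝ), (∃ i, y i ∉ K i.1) → ρ y = 0 :=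
      fun y ⟨i, hi⟩ => Finset.prod_eq_zero (Finset.mem_univ i) (truncatedDensity_of_notMem hi)
    have hπ : ∀ θ ∈ Set.univ.pi Θ, ∀ y, condDensity Q K later (replace θ later y) = ρ y := by
      intro θ hθ y
      by_cases hy : ∀ i, y i ∈ K i.1
      · rw [ih' _ (replace_mem hθ fun i => hKΘ _ (hy i)), Finset.prod_subtype (F := inferInstance)
          (p := (· ∈ later)) _ (by simp)]
        simp only [hρ, replace_of_mem]
      · push Not at hy
        obtain ⟨i, hi⟩ := hy
        rw [hρ0 y ⟨i, hi⟩, condDensity_of_notMem i.2]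
        rwa [replace_of_mem]
    have hρint : ∫ y, ρ y = 1 := by
      rw [hρ, volume_pi, integral_fintype_prod_eq_prod (𝕜 := ℝ)
        (fun (i : {i : J // i ∈ later}) x => truncatedDensity (A i.1) (K i.1) x)]
      exact Finset.prod_eq_one fun i _ => integral_truncatedDensity (hK _) (hAK _) (hpos _)
    have hρcont : ∀ F : (∀ i : {i : J // i ∈ later}, D i.1 → ℝ) → ℝ,
        ContinuousOn F (Set.univ.pi fun i => K i.1) → Integrable fun y => F y * ρ y := by
      intro F hF
      set T : Set (∀ i : {i : J // i ∈ later}, D i.1 → ℝ) := Set.univ.pi fun i => K i.1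
      have hT : IsCompact T := isCompact_univ_pi fun i => hK i.1
      have heq : (fun y => F y * ρ y) = T.indicator fun y => F y *
          ∏ i, (Real.exp (A i.1 (y i) / 2) / ∫ z in K i.1, Real.exp (A i.1 z / 2)) := by
        funext y
        by_cases hy : ∀ i, y i ∈ K i.1
        · rw [Set.indicator_of_mem (show y ∈ T from fun i _ => hy i)]
          simp only [hρ]
          congr 1
          exact Finset.prod_congr rfl fun i _ => Set.indicator_of_mem (hy i) _
        · rw [Set.indicator_of_notMem (fun h : y ∈ T => hy fun i => h i trivial), hρ0 y (by
            push Not at hy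
            exact hy), mul_zero]
      rw [heq, integrable_indicator_iff hT.isClosed.measurableSet]
      refine ContinuousOn.integrableOn_compact hT (hF.mul (continuousOn_finsetProd _ fun i _ => ?_))
      refine ContinuousOn.div_const (Real.continuous_exp.comp_continuousOn
        (ContinuousOn.div_const ((hAK i.1).comp (continuous_apply i).continuousOn ?_) 2)) _
      exact fun y hy => hy i trivial
    set w : (∀ j, D j → ℝ) → ℝ := fun θ => ∫ y, W j (replace θ later y) * ρ y with hw
    have hw_update : ∀ θ x, w (Function.update θ j x) = w θ := by
      intro θ x
      simp only [hw, replace_update θ _ hj, hsep.update]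
    have hexp : ∀ θ ∈ Set.univ.pi Θ, expHalfLog Q later j (condDensity Q K later) θ =
        Real.exp (A j (θ j) / 2) * Real.exp (w θ / 2) := by
      intro θ hθ
      rw [expHalfLog, ← Real.exp_add]
      congr 1
      have hint : ∀ y, Real.log (hDet (Q (replace θ later y)) later j) *
          condDensity Q K later (replace θ later y) =
          A j (θ j) * ρ y + W j (replace θ later y) * ρ y := by
        intro y
        rw [hπ θ hθ]
        by_cases hy : ∀ i, y i ∈ K i.1
        · rw [hsep.log_hDet _ (replace_mem hθ fun i => hKΘ _ (hy i)) later j hj,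
            replace_of_notMem θ y hj]
          ring
        · push Not at hy
          simp [hρ0 y hy]
      simp only [hint]
      have hWc : ContinuousOn (fun y => W j (replace θ later y)) (Set.univ.pi fun i => K i.1) :=
        (hsep.continuousOn_right j).comp (continuous_replace θ later).continuousOn
          fun y hy => replace_mem hθ fun i => hKΘ _ (hy i trivial)
      rw [integral_add (hρcont _ continuousOn_const) (hρcont _ hWc), integral_const_mul, hρint]
      simp only [hw]
      ring
    rw [condDensity, ih' θ hθ, List.toFinset_cons, Finset.prod_insert (by simpa using hj)]
    congr 1
    by_cases hθK : θ j ∈ K j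
    · rw [truncatedDensity, Set.indicator_of_mem hθK, Set.indicator_of_mem hθK]
      have hZ : ∫ z in K j, expHalfLog Q later j (condDensity Q K later) (Function.update θ j z) =
          (∫ z in K j, Real.exp (A j z / 2)) * Real.exp (w θ / 2) := by
        rw [← integral_mul_const]
        refine setIntegral_congr_fun (hK j).isClosed.measurableSet fun z hz => ?_
        rw [hexp _ (update_mem hθ (hKΘ j hz)), hw_update, Function.update_self]
      rw [hZ, hexp _ (update_mem hθ (hKΘ j hθK)), hw_update, Function.update_self,
        mul_div_mul_right _ _ (Real.exp_pos _).ne']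
    · rw [truncatedDensity, Set.indicator_of_notMem hθK, Set.indicator_of_notMem hθK]

omit [DecidableEq J] [∀ j, DecidableEq (D j)] [Fintype J] in
theorem exists_isCompactExhaustion (hΘ : ∀ j, IsOpen (Θ j)) : ∃ K, IsCompactExhaustion Θ K := by
  have (j : J) : LocallyCompactSpace (Θ j) := (hΘ j).locallyCompactSpace
  refine ⟨fun t j => Subtype.val '' (CompactExhaustion.choice (Θ j) t),
    fun t j => (CompactExhaustion.isCompact _ t).image continuous_subtype_val,
    fun j s t h => Set.image_mono (CompactExhaustion.subset _ h), fun j => ?_⟩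
  rw [← Set.image_iUnion, CompactExhaustion.iUnion_eq, Set.image_univ, Subtype.range_coe]

omit [DecidableEq J] [∀ j, DecidableEq (D j)] [Fintype J] in
omit [(j : J) → Fintype (D j)] in
theorem IsCompactExhaustion.eventually_mem {K : ℕ → ∀ j, Set (D j → ℝ)}
    (hK : IsCompactExhaustion Θ K) {j : J} {x : D j → ℝ} (hx : x ∈ Θ j) :
    ∀ᶠ t in Filter.atTop, x ∈ K t j := by
  rw [← hK.union j] at hx
  obtain ⟨t, ht⟩ := Set.mem_iUnion.1 hx
  filter_upwards [Filter.eventually_ge_atTop t] with s hs using hK.mono j hs ht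

omit [DecidableEq J] [∀ j, DecidableEq (D j)] [Fintype J] in
theorem IsCompactExhaustion.eventually_volume_ne_zero {K : ℕ → ∀ j, Set (D j → ℝ)}
    (hK : IsCompactExhaustion Θ K) {j : J} (hΘ : IsOpen (Θ j)) (hne : (Θ j).Nonempty) :
    ∀ᶠ t in Filter.atTop, volume (K t j) ≠ 0 := by
  have h : ∃ t, volume (K t j) ≠ 0 := by
    by_contra! h
    refine (hΘ.measure_pos volume hne).ne' ?_
    rw [← hK.union j]
    exact measure_iUnion_null h
  obtain ⟨t, ht⟩ := h
  filter_upwards [Filter.eventually_ge_atTop t] with s hs h0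
  exact ht (measure_mono_null (hK.mono j hs) h0)

/-- In a separable model the normalized reference densities on compact sets are eventually equal
to the ratios of the product of the functions `exp (A j / 2)`. -/
theorem IsSeparable.tendsto (hsep : IsSeparable Θ Q A W) (hΘ : ∀ j, IsOpen (Θ j)) {L : List J}
    (hL : IsOrdering L) {K : ℕ → ∀ j, Set (D j → ℝ)} (hK : IsCompactExhaustion Θ K)
    {θ₀ θ : ∀ j, D j → ℝ} (hθ₀ : θ₀ ∈ Set.univ.pi Θ) (hθ : θ ∈ Set.univ.pi Θ) :
    Filter.Tendsto (fun t => condDensity Q (K t) L θ / condDensity Q (K t) L θ₀) Filter.atTop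
      (nhds ((∏ j, Real.exp (A j (θ j) / 2)) / ∏ j, Real.exp (A j (θ₀ j) / 2))) := by
  refine tendsto_const_nhds.congr' ?_
  have h1 : ∀ᶠ t in Filter.atTop, ∀ j, θ j ∈ K t j :=
    Filter.eventually_all.2 fun j => hK.eventually_mem (hθ j trivial)
  have h2 : ∀ᶠ t in Filter.atTop, ∀ j, θ₀ j ∈ K t j :=
    Filter.eventually_all.2 fun j => hK.eventually_mem (hθ₀ j trivial)
  have h3 : ∀ᶠ t in Filter.atTop, ∀ j, volume (K t j) ≠ 0 :=
    Filter.eventually_all.2 fun j =>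
      hK.eventually_volume_ne_zero (hΘ j) ⟨θ j, hθ j trivial⟩
  filter_upwards [h1, h2, h3] with t h1 h2 h3
  have hsub : ∀ j, K t j ⊆ Θ j := fun j => hK.union j ▸ Set.subset_iUnion (fun t => K t j) t
  have huniv : L.toFinset = Finset.univ := by
    ext j
    simpa using hL.2 j
  rw [condDensity_eq_prod hsep (hK.compact t) hsub h3 hL.1 hθ,
    condDensity_eq_prod hsep (hK.compact t) hsub h3 hL.1 hθ₀, huniv, ← Finset.prod_div_distrib,
    ← Finset.prod_div_distrib]
  refine Finset.prod_congr rfl fun j _ => ?_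
  have hZ := setIntegral_exp_pos (hK.compact t j) ((hsep.continuousOn_left j).mono (hsub j)) (h3 j)
  rw [truncatedDensity, truncatedDensity, Set.indicator_of_mem (h1 j),
    Set.indicator_of_mem (h2 j), div_div_div_cancel_right₀ hZ.ne']

theorem IsSeparable.isReferencePrior_iff (hsep : IsSeparable Θ Q A W) (hΘ : ∀ j, IsOpen (Θ j))
    (hne : ∀ j, (Θ j).Nonempty) {L : List J} (hL : IsOrdering L) (π : (∀ j, D j → ℝ) → ℝ) :
    IsReferencePrior Θ Q L π ↔
      ∃ c : ℝ, 0 < c ∧ ∀ θ ∈ Set.univ.pi Θ, π θ = c * ∏ j, Real.exp (A j (θ j) / 2) := by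
  have hκ : ∀ θ : (∀ j, D j → ℝ), 0 < ∏ j, Real.exp (A j (θ j) / 2) := fun θ =>
    Finset.prod_pos fun j _ => Real.exp_pos _
  constructor
  · intro h
    obtain ⟨K, hK⟩ := exists_isCompactExhaustion hΘ
    choose θ₀ hθ₀ using hne
    obtain ⟨c, hc, hlim⟩ := h K hK θ₀ fun j _ => hθ₀ j
    refine ⟨c⁻¹ * (∏ j, Real.exp (A j (θ₀ j) / 2))⁻¹,
      mul_pos (inv_pos.2 hc) (inv_pos.2 (hκ θ₀)), fun θ hθ => ?_⟩
    have := tendsto_nhds_unique (hlim θ hθ) (hsep.tendsto hΘ hL hK (fun j _ => hθ₀ j) hθ)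
    rw [mul_assoc, eq_inv_mul_iff_mul_eq₀ hc.ne', this, div_eq_inv_mul]
  · rintro ⟨c, hc, hπ⟩ K hK θ₀ hθ₀
    refine ⟨c⁻¹ * (∏ j, Real.exp (A j (θ₀ j) / 2))⁻¹,
      mul_pos (inv_pos.2 hc) (inv_pos.2 (hκ θ₀)), fun θ hθ => ?_⟩
    convert hsep.tendsto hΘ hL hK hθ₀ hθ using 2
    rw [hπ θ hθ, div_eq_inv_mul]
    field_simp

end Reference

/-! ### The Dirichlet integral -/

section Gamma

/-- The integrand of the Gamma integral, extended by zero to the whole line. -/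
noncomputable def gammaKernel (s x : ℝ) : ℝ :=
  (Set.Ioi (0 : ℝ)).indicator (fun x => Real.exp (-x) * x ^ (s - 1)) x

theorem gammaKernel_of_pos (s : ℝ) {x : ℝ} (hx : 0 < x) :
    gammaKernel s x = Real.exp (-x) * x ^ (s - 1) :=
  Set.indicator_of_mem (Set.mem_Ioi.2 hx) _

theorem gammaKernel_of_nonpos (s : ℝ) {x : ℝ} (hx : x ≤ 0) : gammaKernel s x = 0 :=
  Set.indicator_of_notMem (by simpa using hx) _

theorem gammaKernel_nonneg (s x : ℝ) : 0 ≤ gammaKernel s x :=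
  Set.indicator_nonneg (fun _ hx => mul_nonneg (Real.exp_pos _).le
    (Real.rpow_nonneg (le_of_lt hx) _)) x

theorem measurable_gammaKernel (s : ℝ) : Measurable (gammaKernel s) :=
  Measurable.indicator (by fun_prop) measurableSet_Ioi

theorem integrable_gammaKernel {s : ℝ} (hs : 0 < s) : Integrable (gammaKernel s) :=
  (integrable_indicator_iff measurableSet_Ioi).2 (Real.GammaIntegral_convergent hs)

theorem integral_gammaKernel {s : ℝ} (hs : 0 < s) : ∫ x, gammaKernel s x = Real.Gamma s := by
  rw [Real.Gamma_eq_integral hs]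
  exact integral_indicator measurableSet_Ioi

theorem lintegral_gammaKernel {s : ℝ} (hs : 0 < s) :
    ∫⁻ x, ENNReal.ofReal (gammaKernel s x) = ENNReal.ofReal (Real.Gamma s) := by
  rw [← integral_gammaKernel hs, ofReal_integral_eq_lintegral_ofReal (integrable_gammaKernel hs)
    (ae_of_all _ (gammaKernel_nonneg s))]

theorem lintegral_prod_gammaKernel {ι : Type*} [Fintype ι] {α : ι → ℝ} (hα : ∀ i, 0 < α i) :
    ∫⁻ y : ι → ℝ, ENNReal.ofReal (∏ i, gammaKernel (α i) (y i)) =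
      ENNReal.ofReal (∏ i, Real.Gamma (α i)) := by
  have hint : Integrable (fun y : ι → ℝ => ∏ i, gammaKernel (α i) (y i)) :=
    Integrable.fintype_prod fun i => integrable_gammaKernel (hα i)
  rw [← ofReal_integral_eq_lintegral_ofReal hint
    (ae_of_all _ fun y => Finset.prod_nonneg fun i _ => gammaKernel_nonneg _ _), volume_pi,
    integral_fintype_prod_eq_prod (𝕜 := ℝ) (fun i x => gammaKernel (α i) x)]
  simp only [integral_gammaKernel (hα _)]

end Gamma

section Dirichlet

variable {A : Type*} [Fintype A] [DecidableEq A] {a₀ : A} {α : A → ℝ}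

/-- The unnormalized Dirichlet density, extended by zero to the whole space. -/
noncomputable def dirichletKernel (a₀ : A) (α : A → ℝ) (x : {a : A // a ≠ a₀} → ℝ) : ℝ :=
  (openSimplex a₀).indicator (fun x => ∏ a, fullProb a₀ x a ^ (α a - 1)) x

theorem dirichletKernel_nonneg (α : A → ℝ) (x : {a : A // a ≠ a₀} → ℝ) :
    0 ≤ dirichletKernel a₀ α x :=
  Set.indicator_nonneg (fun _ hx => Finset.prod_nonneg fun a _ =>
    Real.rpow_nonneg (mem_openSimplex_iff.1 hx a).le _) x

theorem measurable_dirichletKernel (α : A → ℝ) : Measurable (dirichletKernel a₀ α) :=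
  Measurable.indicator (Finset.measurable_fun_prod _ fun a _ =>
    (continuous_fullProb a).measurable.pow_const _) (isOpen_openSimplex a₀).measurableSet

/-- With `y = t x`, the joint density of independent Gamma variables with sum `t` factorizes into
the Gamma density of `t` and the Dirichlet density of `x`. -/
theorem prod_gammaKernel_smul (α : A → ℝ) {t : ℝ} (ht : 0 < t) (x : {a : A // a ≠ a₀} → ℝ) :
    t ^ Fintype.card {a : A // a ≠ a₀} * ((∏ i : {a : A // a ≠ a₀}, gammaKernel (α i) (t * x i)) *
      gammaKernel (α a₀) (t - ∑ i, t * x i)) =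
      gammaKernel (∑ a, α a) t * dirichletKernel a₀ α x := by
  have hlast : t - ∑ i, t * x i = t * fullProb a₀ x a₀ := by
    rw [fullProb_base, ← Finset.mul_sum]
    ring
  have hcoe : ∀ i : {a : A // a ≠ a₀}, t * x i = t * fullProb a₀ x i := fun i => by
    rw [fullProb_coe]
  rw [hlast]
  simp only [hcoe]
  rw [prod_subtype_ne_mul a₀ fun a => gammaKernel (α a) (t * fullProb a₀ x a), dirichletKernel]
  by_cases hx : x ∈ openSimplex a₀
  · have hpos := mem_openSimplex_iff.1 hx
    rw [Set.indicator_of_mem hx, gammaKernel_of_pos _ ht]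
    have h1 : ∀ a, gammaKernel (α a) (t * fullProb a₀ x a) =
        Real.exp (-(t * fullProb a₀ x a)) * t ^ (α a - 1) * fullProb a₀ x a ^ (α a - 1) := by
      intro a
      rw [gammaKernel_of_pos _ (mul_pos ht (hpos a)), Real.mul_rpow ht.le (hpos a).le, mul_assoc]
    have h2 : t ^ Fintype.card {a : A // a ≠ a₀} * ∏ a, t ^ (α a - 1) =
        t ^ (∑ a, α a - 1) := by
      rw [← Real.rpow_natCast, ← Real.rpow_sum_of_pos ht, ← Real.rpow_add ht]
      congr 1
      have hcard : (Fintype.card {a : A // a ≠ a₀} : ℝ) + 1 = Fintype.card A := by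
        have := sum_subtype_ne_add a₀ fun _ => (1 : ℝ)
        simpa using this
      rw [Finset.sum_sub_distrib, Finset.sum_const, Finset.card_univ, nsmul_eq_mul, mul_one,
        ← hcard]
      ring
    simp only [h1, Finset.prod_mul_distrib]
    rw [← Real.exp_sum, Finset.sum_neg_distrib, ← Finset.mul_sum, sum_fullProb, mul_one, ← h2]
    ring
  · rw [Set.indicator_of_notMem hx, mul_zero]
    rw [mem_openSimplex_iff] at hx
    push Not at hx
    obtain ⟨a, ha⟩ := hx
    rw [Finset.prod_eq_zero (Finset.mem_univ a)
      (gammaKernel_of_nonpos _ (mul_nonpos_of_nonneg_of_nonpos ht.le ha)), mul_zero]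

theorem lintegral_comp_smul {ι : Type*} [Fintype ι] {f : (ι → ℝ) → ENNReal} (hf : Measurable f)
    {t : ℝ} (ht : 0 < t) :
    ∫⁻ y, f y = ENNReal.ofReal (t ^ Fintype.card ι) * ∫⁻ x, f (t • x) := by
  have h := Measure.map_addHaar_smul (volume : Measure (ι → ℝ)) ht.ne'
  have hpos : 0 < t ^ Fintype.card ι := pow_pos ht _
  rw [← lintegral_map hf (measurable_const_smul t), h, lintegral_smul_measure,
    Module.finrank_fintype_fun_eq_card, abs_of_pos (inv_pos.2 hpos), smul_eq_mul, ← mul_assoc,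
    ← ENNReal.ofReal_mul hpos.le, mul_inv_cancel₀ hpos.ne', ENNReal.ofReal_one, one_mul]

/-- The Dirichlet integral: the integral of the joint density of independent Gamma variables is
evaluated in two ways, with the sum `t` of the variables as the last coordinate. -/
theorem lintegral_dirichletKernel (hα : ∀ a, 0 < α a) :
    ENNReal.ofReal (Real.Gamma (∑ a, α a)) * ∫⁻ x, ENNReal.ofReal (dirichletKernel a₀ α x) =
      ENNReal.ofReal (∏ a, Real.Gamma (α a)) := by
  have hsum : 0 < ∑ a, α a := Finset.sum_pos (fun a _ => hα a) ⟨a₀, Finset.mem_univ _⟩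
  set P : ({a : A // a ≠ a₀} → ℝ) → ℝ := fun y => ∏ i : {a : A // a ≠ a₀}, gammaKernel (α i) (y i)
  have hP0 : ∀ y, 0 ≤ P y := fun y => Finset.prod_nonneg fun i _ => gammaKernel_nonneg _ _
  have hPm : Measurable P := Finset.measurable_fun_prod _ fun i _ =>
    (measurable_gammaKernel _).comp (measurable_pi_apply i)
  set g : ({a : A // a ≠ a₀} → ℝ) → ℝ → ENNReal := fun y t =>
    ENNReal.ofReal (P y * gammaKernel (α a₀) (t - ∑ i, y i))
  have hgm : Measurable (Function.uncurry g) := by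
    refine ENNReal.measurable_ofReal.comp ((hPm.comp measurable_fst).mul
      ((measurable_gammaKernel _).comp ?_))
    fun_prop
  have h1 : ∫⁻ y, ∫⁻ t, g y t = ENNReal.ofReal (∏ a, Real.Gamma (α a)) := by
    have hin : ∀ y, ∫⁻ t, g y t =
        ENNReal.ofReal (P y) * ENNReal.ofReal (Real.Gamma (α a₀)) := by
      intro y
      simp only [g, ENNReal.ofReal_mul (hP0 y)]
      rw [lintegral_const_mul _ (by
        exact ENNReal.measurable_ofReal.comp ((measurable_gammaKernel _).comp (by fun_prop))),
        lintegral_sub_right_eq_self (fun z => ENNReal.ofReal (gammaKernel (α a₀) z)),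
        lintegral_gammaKernel (hα a₀)]
    simp only [hin]
    rw [lintegral_mul_const _ hPm.ennreal_ofReal, lintegral_prod_gammaKernel
      fun i : {a : A // a ≠ a₀} => hα i, ← ENNReal.ofReal_mul (Finset.prod_nonneg fun i _ =>
        (Real.Gamma_pos_of_pos (hα _)).le), prod_subtype_ne_mul a₀ fun a => Real.Gamma (α a)]
  have h2 : ∀ t, ∫⁻ y, g y t = ENNReal.ofReal (gammaKernel (∑ a, α a) t) *
      ∫⁻ x, ENNReal.ofReal (dirichletKernel a₀ α x) := by
    intro t
    rcases le_or_gt t 0 with ht | ht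
    · rw [gammaKernel_of_nonpos _ ht, ENNReal.ofReal_zero, zero_mul]
      refine (lintegral_congr fun y => ?_).trans lintegral_zero
      simp only [g]
      by_cases hy : ∀ i, 0 < y i
      · rw [gammaKernel_of_nonpos, mul_zero, ENNReal.ofReal_zero]
        have := Finset.sum_nonneg fun i (_ : i ∈ Finset.univ) => (hy i).le
        linarith
      · push Not at hy
        obtain ⟨i, hi⟩ := hy
        have : P y = 0 := Finset.prod_eq_zero (Finset.mem_univ i) (gammaKernel_of_nonpos _ hi)
        rw [this, zero_mul, ENNReal.ofReal_zero]
    · have hgt : Measurable fun y => g y t := hgm.comp (measurable_id.prodMk measurable_const)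
      have hgs : Measurable fun x => g (t • x) t := hgt.comp (measurable_const_smul t)
      rw [lintegral_comp_smul hgt ht, ← lintegral_const_mul _ hgs,
        ← lintegral_const_mul _ (measurable_dirichletKernel α).ennreal_ofReal]
      refine lintegral_congr fun x => ?_
      rw [← ENNReal.ofReal_mul (pow_pos ht _).le, ← ENNReal.ofReal_mul (gammaKernel_nonneg _ _),
        ← prod_gammaKernel_smul α ht x]
      rfl
  rw [← h1, lintegral_lintegral_swap hgm.aemeasurable]
  simp only [h2]
  rw [lintegral_mul_const _ (measurable_gammaKernel _).ennreal_ofReal,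
    lintegral_gammaKernel hsum]

theorem integrable_dirichletKernel (hα : ∀ a, 0 < α a) : Integrable (dirichletKernel a₀ α) := by
  refine ⟨(measurable_dirichletKernel α).aestronglyMeasurable, ?_⟩
  rw [hasFiniteIntegral_iff_ofReal (ae_of_all _ (dirichletKernel_nonneg α)), lt_top_iff_ne_top]
  intro h
  have := lintegral_dirichletKernel (a₀ := a₀) hα
  have hsum : 0 < ∑ a, α a := Finset.sum_pos (fun a _ => hα a) ⟨a₀, Finset.mem_univ _⟩
  rw [h, ENNReal.mul_top (by simpa using Real.Gamma_pos_of_pos hsum)] at this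
  exact ENNReal.ofReal_ne_top this.symm

theorem integral_dirichletKernel (hα : ∀ a, 0 < α a) :
    Real.Gamma (∑ a, α a) * ∫ x, dirichletKernel a₀ α x = ∏ a, Real.Gamma (α a) := by
  have hsum : 0 < ∑ a, α a := Finset.sum_pos (fun a _ => hα a) ⟨a₀, Finset.mem_univ _⟩
  have h := lintegral_dirichletKernel (a₀ := a₀) hα
  have hΓ := (Real.Gamma_pos_of_pos hsum).le
  rw [← ofReal_integral_eq_lintegral_ofReal (integrable_dirichletKernel hα)
    (ae_of_all _ (dirichletKernel_nonneg α)), ← ENNReal.ofReal_mul hΓ] at h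
  exact (ENNReal.ofReal_eq_ofReal_iff (mul_nonneg hΓ
    (integral_nonneg (dirichletKernel_nonneg α))) (Finset.prod_nonneg fun a _ =>
    (Real.Gamma_pos_of_pos (hα a)).le)).1 h

theorem indicator_dirichletDensity (α : A → ℝ) :
    (openSimplex a₀).indicator (dirichletDensity a₀ α) = fun x =>
      Real.Gamma (∑ a, α a) / (∏ a, Real.Gamma (α a)) * dirichletKernel a₀ α x := by
  funext x
  by_cases hx : x ∈ openSimplex a₀
  · rw [dirichletKernel, Set.indicator_of_mem hx, Set.indicator_of_mem hx, dirichletDensity]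
  · rw [dirichletKernel, Set.indicator_of_notMem hx, Set.indicator_of_notMem hx, mul_zero]

theorem integrable_indicator_dirichletDensity (hα : ∀ a, 0 < α a) :
    Integrable ((openSimplex a₀).indicator (dirichletDensity a₀ α)) := by
  rw [indicator_dirichletDensity]
  exact (integrable_dirichletKernel hα).const_mul _

theorem integral_indicator_dirichletDensity (hα : ∀ a, 0 < α a) :
    ∫ x, (openSimplex a₀).indicator (dirichletDensity a₀ α) x = 1 := by
  rw [indicator_dirichletDensity, integral_const_mul, div_mul_eq_mul_div,
    integral_dirichletKernel hα]
  exact div_self (Finset.prod_pos fun a _ => Real.Gamma_pos_of_pos (hα a)).ne'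

end Dirichlet

/-! ### The reference prior and the Dirichlet family for `p^cond` -/

section Dirichlet

variable {A : Type*} [Fintype A] [DecidableEq A] {a₀ : A} {α : A → ℝ}

/-- The normalizing constant of the Dirichlet density. -/
noncomputable def dirichletConst (α : A → ℝ) : ℝ :=
  Real.Gamma (∑ a, α a) / ∏ a, Real.Gamma (α a)

omit [DecidableEq A] in
theorem dirichletConst_pos [Nonempty A] (hα : ∀ a, 0 < α a) : 0 < dirichletConst α :=
  div_pos (Real.Gamma_pos_of_pos (Finset.sum_pos (fun a _ => hα a) Finset.univ_nonempty))
    (Finset.prod_pos fun a _ => Real.Gamma_pos_of_pos (hα a))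

theorem dirichletDensity_half {x : {a : A // a ≠ a₀} → ℝ} (hx : x ∈ openSimplex a₀) :
    dirichletDensity a₀ (fun _ => 1 / 2) x =
      dirichletConst (fun _ : A => (1 / 2 : ℝ)) * (∏ a, fullProb a₀ x a) ^ (-(1 / 2) : ℝ) := by
  rw [dirichletDensity, ← Real.finsetProd_rpow _ _
    fun a _ => (mem_openSimplex_iff.1 hx a).le, dirichletConst]
  norm_num

theorem jeffreysMultinomial_eq_mul {x : {a : A // a ≠ a₀} → ℝ} (hx : x ∈ openSimplex a₀) (M : ℕ) :
    jeffreysMultinomial a₀ M x = Real.sqrt ((M : ℝ) ^ Fintype.card {a : A // a ≠ a₀}) *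
      (∏ a, fullProb a₀ x a) ^ (-(1 / 2) : ℝ) := by
  have hprod : 0 ≤ ∏ a, fullProb a₀ x a :=
    Finset.prod_nonneg fun a _ => (mem_openSimplex_iff.1 hx a).le
  rw [jeffreysMultinomial_eq hx, Real.sqrt_mul (by positivity), Finset.prod_inv_distrib,
    Real.rpow_neg hprod, Real.sqrt_inv, ← Real.sqrt_eq_rpow]

theorem prod_pow_mul_dirichletDensity [Nonempty A] {x : {a : A // a ≠ a₀} → ℝ}
    (hx : x ∈ openSimplex a₀) (hα : ∀ a, 0 < α a) (n : A → ℕ) :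
    (∏ a, fullProb a₀ x a ^ n a) * dirichletDensity a₀ α x =
      dirichletConst α / dirichletConst (fun a => α a + n a) *
        dirichletDensity a₀ (fun a => α a + n a) x := by
  have hc : dirichletConst (fun a => α a + n a) ≠ 0 :=
    (dirichletConst_pos fun a => add_pos_of_pos_of_nonneg (hα a) (Nat.cast_nonneg _)).ne'
  have hpow : ∏ a, fullProb a₀ x a ^ (α a + n a - 1) =
      (∏ a, fullProb a₀ x a ^ n a) * ∏ a, fullProb a₀ x a ^ (α a - 1) := by
    rw [← Finset.prod_mul_distrib]
    refine Finset.prod_congr rfl fun a _ => ?_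
    rw [← Real.rpow_natCast, ← Real.rpow_add (mem_openSimplex_iff.1 hx a)]
    ring_nf
  rw [dirichletDensity, dirichletDensity, hpow, ← dirichletConst, ← dirichletConst]
  field_simp

end Dirichlet

section Graph

variable {V : Type*} [Fintype V] [DecidableEq V] {k : ℕ} {Lv : V → Type*} [∀ v, Fintype (Lv v)]
  [∀ v, DecidableEq (Lv v)] {C : Fin k → Finset V} {base : ∀ v, Lv v}

omit [Fintype V] in
theorem refKernel_eq_prod (η : Param C base) :
    refKernel C base η = ∏ j, (∏ r, groupProb C base η j r) ^ (-(1 / 2) : ℝ) :=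
  (Fintype.prod_sigma
    fun j : Group Lv C => (∏ r, groupProb C base η j r) ^ (-(1 / 2) : ℝ)).symm

omit [Fintype V] in
theorem refKernel_eq_prod_exp {η : Param C base} (hη : η ∈ paramSpace C base) :
    refKernel C base η = ∏ j, Real.exp (negLogProd C base j (η j) / 2) := by
  rw [refKernel_eq_prod]
  refine Finset.prod_congr rfl fun j _ => ?_
  have hpos := groupProb_pos hη j
  rw [Real.rpow_def_of_pos (Finset.prod_pos fun r _ => hpos r),
    Real.log_prod fun r _ => (hpos r).ne', negLogProd]
  simp only [groupProb]
  congr 1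
  ring

omit [Fintype V] in
theorem isOpen_groupSpace (C : Fin k → Finset V) (base : ∀ v, Lv v) (j : Group Lv C) :
    IsOpen (groupSpace C base j) :=
  isOpen_openSimplex _

/-- The probabilities of the separator cells enter `log |h_j|` only additively. -/
theorem isSeparable_infoMatrix (hC : initialUnion C k = Finset.univ) {N : ℕ} (hN : 0 < N) :
    IsSeparable (groupSpace C base) (infoMatrix C base N) (negLogProd C base)
      (fun j η => Fintype.card (Coord C base j) *
        Real.log (N * marginal (cellProb C base η) (sep C j.1) j.2)) where
  log_hDet η hη later j hj := log_hDet_infoMatrix hη hC hN hj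
  update η j x := by rw [marginal_sep_update hC]
  continuousOn_right j := by
    refine continuousOn_const.mul (ContinuousOn.log
      (continuous_const.mul (continuous_marginal _ _)).continuousOn fun η hη => ?_)
    have h1 := marginal_sep_pos hη j
    have h3 : (0 : ℝ) < N := by exact_mod_cast hN
    exact (mul_pos h3 h1).ne'
  continuousOn_left j := by
    refine ContinuousOn.neg (continuousOn_finsetSum _ fun r _ => ContinuousOn.log
      (continuous_fullProb r).continuousOn fun x hx => ?_)
    exact (mem_openSimplex_iff.1 hx r).ne'

theorem isReferencePrior_infoMatrix_iff (hC : initialUnion C k = Finset.univ) {N : ℕ}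
    (hN : 0 < N) {L : List (Group Lv C)} (hL : IsOrdering L) (π : Param C base → ℝ) :
    IsReferencePrior (groupSpace C base) (infoMatrix C base N) L π ↔
      ∃ c : ℝ, 0 < c ∧ ∀ η ∈ paramSpace C base, π η = c * refKernel C base η := by
  rw [(isSeparable_infoMatrix hC hN).isReferencePrior_iff (isOpen_groupSpace C base)
    (fun j => openSimplex_nonempty _) hL]
  refine exists_congr fun c => and_congr_right fun _ => forall₂_congr fun η hη => ?_
  rw [refKernel_eq_prod_exp hη]

omit [Fintype V] in
theorem dirichletProduct_half {η : Param C base} (hη : η ∈ paramSpace C base) :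
    dirichletProduct C base (fun _ _ => 1 / 2) η =
      (∏ j : Group Lv C, dirichletConst fun _ : Cell C j => (1 / 2 : ℝ)) *
        refKernel C base η := by
  rw [refKernel_eq_prod, dirichletProduct, ← Finset.prod_mul_distrib]
  exact Finset.prod_congr rfl fun j _ => dirichletDensity_half (hη j trivial)

omit [Fintype V] in
theorem indicator_dirichletProduct (α : ∀ j : Group Lv C, Cell C j → ℝ) :
    (paramSpace C base).indicator (dirichletProduct C base α) = fun η =>
      ∏ j, (groupSpace C base j).indicator (dirichletDensity (baseCell C base j) (α j)) (η j) := by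
  funext η
  by_cases hη : η ∈ paramSpace C base
  · rw [Set.indicator_of_mem hη]
    exact Finset.prod_congr rfl fun j _ => (Set.indicator_of_mem (hη j trivial) _).symm
  · rw [Set.indicator_of_notMem hη]
    have : ∃ j, η j ∉ groupSpace C base j := by
      by_contra! h
      exact hη fun j _ => h j
    obtain ⟨j, hj⟩ := this
    exact (Finset.prod_eq_zero (Finset.mem_univ j) (Set.indicator_of_notMem hj _)).symm

theorem measurableSet_paramSpace (C : Fin k → Finset V) (base : ∀ v, Lv v) :
    MeasurableSet (paramSpace C base) :=
  (isOpen_set_pi Set.finite_univ fun j _ => isOpen_groupSpace C base j).measurableSet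

theorem integrableOn_dirichletProduct {α : ∀ j : Group Lv C, Cell C j → ℝ}
    (hα : ∀ j r, 0 < α j r) : IntegrableOn (dirichletProduct C base α) (paramSpace C base) := by
  rw [← integrable_indicator_iff (measurableSet_paramSpace C base), indicator_dirichletProduct]
  exact Integrable.fintype_prod_dep fun j => integrable_indicator_dirichletDensity (hα j)

theorem setIntegral_dirichletProduct {α : ∀ j : Group Lv C, Cell C j → ℝ}
    (hα : ∀ j r, 0 < α j r) : ∫ η in paramSpace C base, dirichletProduct C base α η = 1 := by
  rw [← integral_indicator (measurableSet_paramSpace C base), indicator_dirichletProduct,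
    volume_pi, integral_fintype_prod_eq_prod (𝕜 := ℝ) (fun j x =>
      (groupSpace C base j).indicator (dirichletDensity (baseCell C base j) (α j)) x)]
  exact Finset.prod_eq_one fun j _ => integral_indicator_dirichletDensity (hα j)

/-- The likelihood is a product of multinomial likelihoods, one for each slice. -/
theorem likelihood_eq (η : Param C base) (n : (∀ v, Lv v) → ℕ) :
    likelihood C base η n = (Nat.multinomial Finset.univ n : ℝ) *
      ∏ j : Group Lv C, ∏ r, groupProb C base η j r ^ sliceEntry n (res C j.1) (sep C j.1) j.2 r := by
  rw [likelihood, multinomialProb]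
  congr 1
  simp only [cellProb, ← Finset.prod_pow]
  rw [Finset.prod_comm, Fintype.prod_sigma]
  refine Finset.prod_congr rfl fun l _ => ?_
  rw [← Finset.prod_fiberwise _ fun i => (sep C l).restrict i]
  refine Finset.prod_congr rfl fun s _ => ?_
  rw [← Finset.prod_fiberwise _ fun i => (res C l).restrict i]
  refine Finset.prod_congr rfl fun r _ => ?_
  rw [sliceEntry, ← Finset.prod_pow_eq_pow_sum, Finset.filter_filter]
  refine Finset.prod_congr rfl fun i hi => ?_
  obtain ⟨h1, h2⟩ : (sep C l).restrict i = s ∧ (res C l).restrict i = r :=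
    (Finset.mem_filter.1 hi).2
  rw [h1, h2]

theorem posterior_dirichletProduct {α : ∀ j : Group Lv C, Cell C j → ℝ}
    (hα : ∀ j r, 0 < α j r) (n : (∀ v, Lv v) → ℕ) {η : Param C base}
    (hη : η ∈ paramSpace C base) :
    posterior C base (dirichletProduct C base α) n η = dirichletProduct C base
      (fun j r => α j r + ((sliceEntry n (res C j.1) (sep C j.1) j.2 r : ℕ) : ℝ)) η := by
  set β : ∀ j : Group Lv C, Cell C j → ℝ := fun j r =>
    α j r + ((sliceEntry n (res C j.1) (sep C j.1) j.2 r : ℕ) : ℝ) with hβdef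
  have hβ : ∀ j r, 0 < β j r := fun j r =>
    add_pos_of_pos_of_nonneg (hα j r) (Nat.cast_nonneg _)
  have hne : ∀ j : Group Lv C, Nonempty (Cell C j) := fun j => ⟨baseCell C base j⟩
  set c : ℝ := Nat.multinomial Finset.univ n *
    ∏ j : Group Lv C, dirichletConst (α j) / dirichletConst (β j)
  have hc : 0 < c := mul_pos (by exact_mod_cast Nat.multinomial_pos _ _)
    (Finset.prod_pos fun j _ => div_pos (dirichletConst_pos (hα j)) (dirichletConst_pos (hβ j)))
  have key : ∀ η ∈ paramSpace C base, likelihood C base η n * dirichletProduct C base α η =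
      c * dirichletProduct C base β η := by
    intro η hη
    rw [likelihood_eq, dirichletProduct, dirichletProduct, mul_assoc, ← Finset.prod_mul_distrib,
      mul_assoc, ← Finset.prod_mul_distrib]
    congr 1
    exact Finset.prod_congr rfl fun j _ =>
      prod_pow_mul_dirichletDensity (hη j trivial) (hα j) _
  rw [posterior, setIntegral_congr_fun (measurableSet_paramSpace C base) key, key η hη,
    integral_const_mul, setIntegral_dirichletProduct hβ, mul_one, mul_div_cancel_left₀ _ hc.ne']

end Graph

end RefPrior

/-! ### The reference prior of a decomposable model -/

open RefPrior in
theorem proposition3p1 {V : Type*} [Fintype V] [DecidableEq V] (G : SimpleGraph V)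
    {Lv : V → Type*} [∀ v, Fintype (Lv v)] [∀ v, DecidableEq (Lv v)]
    (base : ∀ v, Lv v) {k : ℕ} (C : Fin k → Finset V) (hC : IsPerfectCliqueOrdering G C)
    (N : ℕ) (hN : 0 < N) :
    -- `p^cond` is a parametrization of the model: it maps the positive Markov distributions
    -- bijectively onto the product of the open simplices, with inverse `cellProb`
    ((∀ p ∈ markovModel (Lv := Lv) G,
        pcond C base p ∈ paramSpace C base ∧ cellProb C base (pcond C base p) = p) ∧
      ∀ η ∈ paramSpace C base,
        cellProb C base η ∈ markovModel (Lv := Lv) G ∧ pcond C base (cellProb C base η) = η) ∧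
    -- whatever the order `L` of the groups, the reference prior is the kernel, up to a constant
    (∀ L : List (Group Lv C), IsOrdering L → ∀ π : Param C base → ℝ,
      IsReferencePrior (groupSpace C base) (infoMatrix C base N) L π ↔
        ∃ c : ℝ, 0 < c ∧ ∀ η ∈ paramSpace C base, π η = c * refKernel C base η) ∧
    -- it is the product of Dirichlet(1/2, …, 1/2) densities
    (∃ c : ℝ, 0 < c ∧ ∀ η ∈ paramSpace C base,
      dirichletProduct C base (fun _ _ => 1 / 2) η = c * refKernel C base η) ∧
    -- the factor of each group is the Jeffreys prior of that group
    (∀ (j : Group Lv C) (M : ℕ), 0 < M → ∃ c : ℝ, 0 < c ∧ ∀ x ∈ groupSpace C base j,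
      jeffreysMultinomial (baseCell C base j) M x =
        c * dirichletDensity (baseCell C base j) (fun _ => 1 / 2) x) ∧
    -- products of Dirichlet densities, in particular the reference prior, are proper
    (∀ α : (∀ j : Group Lv C, Cell C j → ℝ), (∀ j r, 0 < α j r) →
      MeasureTheory.IntegrableOn (dirichletProduct C base α) (paramSpace C base) ∧
        ∫ η in paramSpace C base, dirichletProduct C base α η = 1) ∧
    -- and they form a conjugate family: the slice counts are added to the hyper-parameters
    (∀ α : (∀ j : Group Lv C, Cell C j → ℝ), (∀ j r, 0 < α j r) →
      ∀ n ∈ countTables (∀ v, Lv v) N, ∀ η ∈ paramSpace C base,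
        posterior C base (dirichletProduct C base α) n η =
          dirichletProduct C base
            (fun j r => α j r + ((sliceEntry n (res C j.1) (sep C j.1) j.2 r : ℕ) : ℝ)) η) := by
  have hU := hC.initialUnion_eq_univ
  refine ⟨⟨fun p hp => ⟨pcond_mem_paramSpace hp.1, cellProb_pcond hC hp⟩,
      fun η hη => ⟨cellProb_mem_markovModel hC hη, pcond_cellProb hC hη⟩⟩,
    fun L hL π => isReferencePrior_infoMatrix_iff hU hN hL π,
    ⟨_, Finset.prod_pos fun j _ => ?_, fun η hη => dirichletProduct_half hη⟩,
    fun j M hM => ?_,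
    fun α hα => ⟨integrableOn_dirichletProduct hα, setIntegral_dirichletProduct hα⟩,
    fun α hα n _ η hη => posterior_dirichletProduct hα n hη⟩
  · have : Nonempty (Cell C j) := ⟨baseCell C base j⟩
    exact dirichletConst_pos fun _ => by norm_num
  · have : Nonempty (Cell C j) := ⟨baseCell C base j⟩
    have hc : 0 < dirichletConst fun _ : Cell C j => (1 / 2 : ℝ) :=
      dirichletConst_pos fun _ => by norm_num
    have hM' : (0 : ℝ) < M := by exact_mod_cast hM
    refine ⟨Real.sqrt ((M : ℝ) ^ Fintype.card (Coord C base j)) /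
      dirichletConst fun _ : Cell C j => (1 / 2 : ℝ),
      div_pos (Real.sqrt_pos.2 (pow_pos hM' _)) hc, fun x hx => ?_⟩
    rw [jeffreysMultinomial_eq_mul hx, dirichletDensity_half hx, ← mul_assoc,
      div_mul_cancel₀ _ hc.ne']
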